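/- Let $n\ge 3$. A \emph{Coxeter--Dynkin diagram} on nodes $1,\dots,n$ consists of a Coxeter matrix $(m_{ij})$ (nodes $i\ne j$ are linked when $m_{ij}\ne 2$; the link is simple if $m_{ij}=3$, double if $m_{ij}=4$, triple if $m_{ij}=6$, and labelled by $m_{ij}$ otherwise) together with the choice, for each double or triple link, of which of its two nodes is the long one. Vectors $\alpha_1,\dots,\alpha_n\in\mathbb R^n$ are \emph{simple roots} with this diagram if they are linearly independent, $\langle\alpha_i,\alpha_j\rangle=-\|\alpha_i\|\|\alpha_j\|\cos(\pi/m_{ij})$ for all $i,j$, and, for linked nodes, $\|\alpha_i\|=\sqrt2\,\|\alpha_j\|$ (resp. $\sqrt3\,\|\alpha_j\|$) when the link is double (resp. triple) with $i$ long, and $\|\alpha_i\|=\|\alpha_j\|$ otherwise. Let $W$ be the group generated by the reflections $r_k$ in the hyperplanes orthogonal to the $\alpha_k$. For $x\in\mathbb R^n$, the polytope generated by $W$ from $x$ is the convex hull of the orbit $Wx$; it is \emph{Platonic} if for every $0\le d\le n-1$ its faces of dimension $d$ form exactly one $W$-orbit. The diagram \emph{gives rise to a Platonic solid in $\mathbb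 R^n$} if there are simple roots in $\mathbb R^n$ with this diagram for which $W$ is finite, and a point $x\in\mathbb R^n$ such that the polytope generated by $W$ from $x$ is Platonic. Then a connected Coxeter--Dynkin diagram with $n\ge 3$ nodes gives rise to a Platonic solid in $\mathbb R^n$ if and only if, up to renumbering of the nodes, it is one of the following lines of nodes: - $A_n$: all links simple; - $B_n$: all links simple except the last, which is double with the last node short; - $C_n$: all links simple except the last, which is double with the last node long; - $F_4$ ($n=4$): the links are simple, double, simple, with the second node long and the third short; - $H_3$ ($n=3$): the links are labelled $3,5$; - $H_4$ ($n=4$): the links are labelled $3,3,5$. -/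

import Mathlib

/-- A Coxeter–Dynkin diagram with set of nodes `ι`. The nodes `i ≠ j` are joined by a link unless
`M i j = 2`; the link is simple for `M i j = 3`, double for `M i j = 4`, triple for `M i j = 6`, and
carries the label `M i j` otherwise (the entry `0` stands for the label `∞`).
Double and triple links join simple roots of different lengths: `longer i j` says that the link
between `i` and `j` is double or triple and that `i` is its long (open) node and `j` its short
(filled) one. -/
structure CoxeterDynkinDiagram (ι : Type*) where
  M : CoxeterMatrix ι
  longer : ι → ι → Prop
  longer_asymm : ∀ i j, longer i j → ¬ longer j i
  multiple_iff : ∀ i j, (M i j = 4 ∨ M i j = 6) ↔ (longer i j ∨ longer j i)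

namespace CoxeterDynkinDiagram

/-- The graph underlying a Coxeter–Dynkin diagram. -/
def graph {ι : Type*} (D : CoxeterDynkinDiagram ι) : SimpleGraph ι where
  Adj i j := i ≠ j ∧ D.M i j ≠ 2
  symm := ⟨fun i j h => ⟨h.1.symm, by rw [D.M.symmetric]; exact h.2⟩⟩
  loopless := ⟨fun _ h => h.1 rfl⟩

/-- A diagram is connected when its underlying graph is. -/
def Connected {ι : Type*} (D : CoxeterDynkinDiagram ι) : Prop := D.graph.Connected

/-- Two diagrams are of the same type when they agree up to a renumbering of the nodes. -/
def SameType {ι κ : Type*} (D : CoxeterDynkinDiagram ι) (E : CoxeterDynkinDiagram κ) : Prop :=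
  ∃ e : ι ≃ κ, (∀ i j, D.M i j = E.M (e i) (e j)) ∧
    ∀ i j, D.longer i j ↔ E.longer (e i) (e j)

/-! ### The diagrams in the classification -/

/-- `A n`: a line of `n` nodes, all links simple. -/
def A (n : ℕ) : CoxeterDynkinDiagram (Fin n) where
  M := CoxeterMatrix.A n
  longer _ _ := False
  longer_asymm _ _ h := h.elim
  multiple_iff i j := by
    simp only [CoxeterMatrix.A, Matrix.of_apply]
    split_ifs <;> simp

/-- `B n`: a line of `n` nodes; the last link is double and the last node is short. -/
def B (n : ℕ) : CoxeterDynkinDiagram (Fin n) where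
  M := CoxeterMatrix.B n
  longer i j := (i : ℕ) + 2 = n ∧ (j : ℕ) + 1 = n
  longer_asymm i j h h' := by omega
  multiple_iff i j := by
    have hi := i.isLt
    have hj := j.isLt
    simp only [CoxeterMatrix.B, Matrix.of_apply, Fin.ext_iff]
    split_ifs <;> simp <;> omega

/-- `C n`: a line of `n` nodes; the last link is double and the last node is long. -/
def C (n : ℕ) : CoxeterDynkinDiagram (Fin n) where
  M := CoxeterMatrix.B n
  longer i j := (i : ℕ) + 1 = n ∧ (j : ℕ) + 2 = n
  longer_asymm i j h h' := by omega
  multiple_iff i j := by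
    have hi := i.isLt
    have hj := j.isLt
    simp only [CoxeterMatrix.B, Matrix.of_apply, Fin.ext_iff]
    split_ifs <;> simp <;> omega

/-- `F₄`: a line of four nodes; the middle link is double, the first two nodes are long and the last
two are short. -/
def F₄ : CoxeterDynkinDiagram (Fin 4) where
  M := CoxeterMatrix.F₄
  longer i j := i = 1 ∧ j = 2
  longer_asymm := by decide
  multiple_iff i j := by
    fin_cases i <;> fin_cases j <;> decide

/-- `H₃`: a line of three nodes with links labelled `3` and `5`. -/
def H₃ : CoxeterDynkinDiagram (Fin 3) where
  M := CoxeterMatrix.H₃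
  longer _ _ := False
  longer_asymm _ _ h := h.elim
  multiple_iff i j := by
    fin_cases i <;> fin_cases j <;> decide

/-- `H₄`: a line of four nodes with links labelled `3`, `3`, `5`. -/
def H₄ : CoxeterDynkinDiagram (Fin 4) where
  M := CoxeterMatrix.H₄
  longer _ _ := False
  longer_asymm _ _ h := h.elim
  multiple_iff i j := by
    fin_cases i <;> fin_cases j <;> decide

/-! ### Simple roots, reflection group, polytopes -/

/-- The vectors `α i` are simple roots with diagram `D`: they are linearly independent, and their
relative angles and relative lengths are those recorded by `D`. -/
structure IsSimpleRoots {ι V : Type*} [NormedAddCommGroup V] [InnerProductSpace ℝ V]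
    (D : CoxeterDynkinDiagram ι) (α : ι → V) : Prop where
  linearIndependent : LinearIndependent ℝ α
  inner_eq : ∀ i j, inner ℝ (α i) (α j) = -(‖α i‖ * ‖α j‖ * Real.cos (Real.pi / (D.M i j : ℝ)))
  norm_eq : ∀ i j, D.graph.Adj i j → ¬ D.longer i j → ¬ D.longer j i → ‖α i‖ = ‖α j‖
  norm_double : ∀ i j, D.longer i j → D.M i j = 4 → ‖α i‖ = Real.sqrt 2 * ‖α j‖
  norm_triple : ∀ i j, D.longer i j → D.M i j = 6 → ‖α i‖ = Real.sqrt 3 * ‖α j‖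

end CoxeterDynkinDiagram

/-- The group generated by the reflections in the hyperplanes orthogonal to the vectors `α i`. -/
noncomputable def reflectionGroup {ι V : Type*} [NormedAddCommGroup V] [InnerProductSpace ℝ V]
    (α : ι → V) : Subgroup (V ≃ₗᵢ[ℝ] V) :=
  Subgroup.closure (Set.range fun i => (ℝ ∙ α i)ᗮ.reflection)

/-- The polytope generated by the group `W` from the single point `x`: the convex hull of the orbit
of `x`. -/
def orbitPolytope {V : Type*} [NormedAddCommGroup V] [InnerProductSpace ℝ V]
    (W : Subgroup (V ≃ₗᵢ[ℝ] V)) (x : V) : Set V :=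
  convexHull ℝ {y | ∃ w ∈ W, y = w x}

/-- The faces of dimension `d` of a polytope `P`: the nonempty sets of dimension `d` on which some
linear functional attains its maximum over `P`. -/
def facesOfDim {V : Type*} [NormedAddCommGroup V] [InnerProductSpace ℝ V]
    (P : Set V) (d : ℕ) : Set (Set V) :=
  {F | F.Nonempty ∧ IsExposed ℝ P F ∧ Module.finrank ℝ (vectorSpan ℝ F) = d}

/-- The polytope generated from `x` by a group `W` acting on an `n`-dimensional space is Platonic
when, for every dimension `0 ≤ d ≤ n - 1`, its faces of dimension `d` form exactly one `W`-orbit (in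
particular there are such faces). -/
def IsPlatonic {V : Type*} [NormedAddCommGroup V] [InnerProductSpace ℝ V]
    (W : Subgroup (V ≃ₗᵢ[ℝ] V)) (x : V) : Prop :=
  ∀ d < Module.finrank ℝ V, ∃ F : Set V,
    facesOfDim (orbitPolytope W x) d = {F' | ∃ w ∈ W, F' = w '' F}

/-- A diagram with `n` nodes gives rise to a Platonic solid in `ℝⁿ` when it is the diagram of simple
roots of `ℝⁿ` whose reflections generate a finite group, and this group generates a Platonic
polytope from some point of `ℝⁿ`. -/
def CoxeterDynkinDiagram.GivesPlatonicSolid {n : ℕ} (D : CoxeterDynkinDiagram (Fin n)) : Prop :=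
  ∃ α : Fin n → EuclideanSpace ℝ (Fin n), D.IsSimpleRoots α ∧
    Finite (reflectionGroup α) ∧
    ∃ x : EuclideanSpace ℝ (Fin n), IsPlatonic (reflectionGroup α) x

/-! Normalising the simple roots gives a basis `b` of unit vectors with inner products -cos(π/m),
nonpositive off the diagonal. The Coxeter group acts through the reflections in `b`, and the engine
of the proof is the root lemma `repr_rep_nonneg`: an element w sends `b i` to a nonnegative
combination of simple roots whenever w s_i is longer than w. It follows that x - g x is a
nonnegative combination for dominant x, that an orbit contains at most one dominant vector, that W
is finite, and that every vector can be moved to a dominant one. Hence, for dominant x, each face of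
conv(Wx) is up to W of the form conv(W_J x), where J is the set of nodes orthogonal to a dominant
normal vector (`face_eq`).

Necessity. Call J grown if it is built node by node, each new node being linked to an earlier one or
having a mirror that misses x (`IsGrown`). Then conv(W_J x) is a face of dimension |J|. Its point
nearest the origin is dominant and determines J, so different grown sets give faces in different
W-orbits. A Platonic polytope therefore admits at most one grown set of each size below n. In a
connected diagram a branch or a cycle would produce two of the same size, so the diagram is a line
(`exists_equiv_of_isPlatonic`). The Gram matrix of a line must be positive definite; testing it on
suitable vectors, mostly null vectors of affine diagrams, leaves only the listed labels
(`IsUnitPath.labels`).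

Sufficiency. On a line, let x be orthogonal to all roots but the first. Then conv(W_J x) depends
only on the nodes before the first one missing from J, so all faces of dimension d are W-translates
of a single one (`isPlatonic_of_path`). Simple roots for each listed diagram come from a Cholesky
factorisation of the Gram matrix, whose pivots are positive (`exists_unit_path`). -/

/-! ### Reflections in unit vectors and the geometric representation of a Coxeter group -/

section GeometricRepresentation

open Real

variable {ι V : Type*} [NormedAddCommGroup V] [InnerProductSpace ℝ V]

/-- The reflection in the hyperplane orthogonal to `v`. -/
noncomputable abbrev rootReflection (v : V) : V ≃ₗᵢ[ℝ] V := (ℝ ∙ v)ᗮ.reflection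

theorem rootReflection_apply {u : V} (hu : inner ℝ u u = (1 : ℝ)) (v : V) :
    rootReflection u v = v - (2 * inner ℝ v u) • u := by
  have hn : ‖u‖ ^ 2 = 1 := by rw [← real_inner_self_eq_norm_sq, hu]
  rw [rootReflection, Submodule.reflection_orthogonal_apply,
    Submodule.reflection_singleton_apply, real_inner_comm]
  simp only [RCLike.ofReal_real_eq_id, id, hn, div_one]
  module

theorem rootReflection_smul {r : ℝ} (hr : r ≠ 0) (u : V) :
    rootReflection (r • u) = rootReflection u := by
  have : (ℝ ∙ (r • u)) = (ℝ ∙ u) := Submodule.span_singleton_smul_eq (IsUnit.mk0 r hr) u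
  unfold rootReflection
  congr 1
  simp only [this]

theorem rootReflection_mul_self (u : V) : rootReflection u * rootReflection u = 1 :=
  Submodule.reflection_mul_reflection _

theorem isometry_mul_apply (f g : V ≃ₗᵢ[ℝ] V) (v : V) : (f * g) v = f (g v) := rfl

/-- A basis of unit vectors whose angles are those prescribed by a Coxeter matrix. -/
structure IsGeometricBasis (M : CoxeterMatrix ι) (b : Module.Basis ι ℝ V) : Prop where
  inner_eq : ∀ i j, inner ℝ (b i) (b j) = -cos (π / (M i j : ℝ))

namespace IsGeometricBasis

variable {M : CoxeterMatrix ι} {b : Module.Basis ι ℝ V}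

theorem inner_self (hb : IsGeometricBasis M b) (i : ι) : inner ℝ (b i) (b i) = (1 : ℝ) := by
  rw [hb.inner_eq]
  simp

theorem norm_eq_one (hb : IsGeometricBasis M b) (i : ι) : ‖b i‖ = 1 := by
  have h := hb.inner_self i
  rw [real_inner_self_eq_norm_sq] at h
  nlinarith [norm_nonneg (b i)]

theorem refl_apply (hb : IsGeometricBasis M b) (i : ι) (v : V) :
    rootReflection (b i) v = v - (2 * inner ℝ v (b i)) • b i :=
  rootReflection_apply (hb.inner_self i) v

/-- The entry 0 encodes the label ∞: since π / 0 = 0, it would give inner product -1, hence `b i + b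
j = 0`, against independence. -/
theorem ne_zero (hb : IsGeometricBasis M b) (i j : ι) : M i j ≠ 0 := by
  intro h
  have hij : i ≠ j := by
    rintro rfl
    simp at h
  have h1 : inner ℝ (b i) (b j) = (-1 : ℝ) := by simp [hb.inner_eq, h]
  have h2 : inner ℝ (b i + b j) (b i + b j) = (0 : ℝ) := by
    rw [inner_add_left, inner_add_right, inner_add_right, real_inner_comm (b i) (b j), h1,
      hb.inner_self, hb.inner_self]
    norm_num
  rw [inner_self_eq_zero] at h2
  have h3 := congrArg (fun v => b.repr v i) h2
  simp [hij.symm] at h3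

theorem two_le (hb : IsGeometricBasis M b) {i j : ι} (hij : i ≠ j) : 2 ≤ M i j := by
  have h0 := hb.ne_zero i j
  have h1 := M.off_diagonal i j hij
  omega

theorem inner_nonpos (hb : IsGeometricBasis M b) {i j : ι} (hij : i ≠ j) :
    inner ℝ (b i) (b j) ≤ (0 : ℝ) := by
  have h2 : (2 : ℝ) ≤ M i j := by exact_mod_cast hb.two_le hij
  rw [hb.inner_eq, neg_nonpos]
  apply cos_nonneg_of_mem_Icc
  constructor
  · have : 0 ≤ π / (M i j : ℝ) := by positivity
    linarith [pi_pos]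
  · exact div_le_div_of_nonneg_left pi_pos.le two_pos h2

theorem inner_eq_zero (hb : IsGeometricBasis M b) {i j : ι} (h : M i j = 2) :
    inner ℝ (b i) (b j) = (0 : ℝ) := by
  simp [hb.inner_eq, h]

theorem inner_neg (hb : IsGeometricBasis M b) {i j : ι} (hij : i ≠ j) (h : M i j ≠ 2) :
    inner ℝ (b i) (b j) < (0 : ℝ) := by
  have h2 : (2 : ℝ) < M i j := by
    have := hb.two_le hij
    exact_mod_cast (by omega : 2 < M i j)
  rw [hb.inner_eq, neg_lt_zero]
  apply cos_pos_of_mem_Ioo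
  constructor
  · have : 0 ≤ π / (M i j : ℝ) := by positivity
    linarith [pi_pos]
  · exact div_lt_div_of_pos_left pi_pos two_pos h2

theorem sin_pos (hb : IsGeometricBasis M b) {i j : ι} (hij : i ≠ j) :
    0 < sin (π / (M i j : ℝ)) := by
  have h2 : (2 : ℝ) ≤ M i j := by exact_mod_cast hb.two_le hij
  apply sin_pos_of_pos_of_lt_pi
  · positivity
  · exact div_lt_self pi_pos (by linarith)

open CoxeterSystem in
/-- The action of an alternating word of two simple reflections on the other simple root. -/
theorem prod_alternatingWord_apply (hb : IsGeometricBasis M b) {i j : ι} (hij : i ≠ j) (k : ℕ) :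
    ((alternatingWord i j k).map fun l => rootReflection (b l)).prod (b i) =
      (sin ((k + 1) * (π / (M i j : ℝ))) / sin (π / (M i j : ℝ))) • b (if Even k then i else j) +
      (sin (k * (π / (M i j : ℝ))) / sin (π / (M i j : ℝ))) • b (if Even k then j else i) := by
  have hs := hb.sin_pos hij
  have hin := hb.inner_eq i j
  have hin' : inner ℝ (b j) (b i) = -cos (π / (M i j : ℝ)) := by rw [real_inner_comm, hin]
  set θ := π / (M i j : ℝ) with hθ
  -- The Chebyshev recurrence obeyed by the coefficients when one more reflection is applied.
  have key (k : ℕ) : 2 * cos θ * sin ((k + 1) * θ) - sin (k * θ) = sin ((k + 1 + 1) * θ) := by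
    have e1 : (k + 1 + 1 : ℝ) * θ = (k + 1) * θ + θ := by ring
    have e2 : (k : ℝ) * θ = (k + 1) * θ - θ := by ring
    rw [e1, e2, sin_add, sin_sub]
    ring
  induction k with
  | zero => simp [alternatingWord, div_self hs.ne']
  | succ k ih =>
    rw [alternatingWord_succ', List.map_cons, List.prod_cons]
    rw [isometry_mul_apply, ih, hb.refl_apply]
    by_cases hk : Even k
    · have hk' : ¬ Even (k + 1) := by simpa [Nat.even_add_one] using hk
      simp only [hk, hk', if_true, if_false, inner_add_left, real_inner_smul_left, hin,
        hb.inner_self]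
      push_cast
      rw [← key k]
      match_scalars <;> field_simp <;> ring
    · have hk' : Even (k + 1) := by simpa [Nat.even_add_one] using hk
      simp only [hk, hk', if_true, if_false, inner_add_left, real_inner_smul_left, hin',
        hb.inner_self]
      push_cast
      rw [← key k]
      match_scalars <;> field_simp <;> ring

/-- The alternating word with 2m letters corresponds to the angle 2m · π/m = 2π in the sine formula.
-/
theorem mul_pow_apply_left (hb : IsGeometricBasis M b) {i j : ι} (hij : i ≠ j) :
    ((rootReflection (b i) * rootReflection (b j)) ^ M i j) (b i) = b i := by
  have h := hb.prod_alternatingWord_apply hij (2 * M i j)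
  have hs := hb.sin_pos hij
  have hM : (M i j : ℝ) ≠ 0 := by exact_mod_cast hb.ne_zero i j
  have e1 : ((2 * M i j : ℕ) : ℝ) * (π / (M i j : ℝ)) = 2 * π := by
    push_cast
    field_simp
  have e2 : (((2 * M i j : ℕ) : ℝ) + 1) * (π / (M i j : ℝ)) = π / (M i j : ℝ) + 2 * π := by
    rw [add_mul, e1]
    ring
  have e3 : ∀ k, ((CoxeterSystem.alternatingWord i j (2 * k)).map
      fun l => rootReflection (b l)).prod = (rootReflection (b i) * rootReflection (b j)) ^ k := by
    intro k
    induction k with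
    | zero => simp [CoxeterSystem.alternatingWord]
    | succ k ih =>
      rw [Nat.mul_succ, CoxeterSystem.alternatingWord_succ', CoxeterSystem.alternatingWord_succ',
        if_neg (by simp), if_pos (by simp), List.map_cons, List.map_cons,
        List.prod_cons, List.prod_cons, ih, pow_succ', mul_assoc]
  rw [e1, e2, sin_add_two_pi, sin_two_pi, div_self hs.ne'] at h
  rw [← e3, h]
  simp

/-- The power fixes `b i`, it fixes `b j` because its inverse does by symmetry, and it fixes the
orthogonal complement of their span pointwise. -/
theorem isLiftable (hb : IsGeometricBasis M b) :
    M.IsLiftable fun i => rootReflection (b i) := by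
  intro i j
  rcases eq_or_ne i j with rfl | hij
  · simp
  have h1 := hb.mul_pow_apply_left hij
  have h2 : ((rootReflection (b i) * rootReflection (b j)) ^ M i j) (b j) = b j := by
    have h := hb.mul_pow_apply_left hij.symm
    have e : rootReflection (b j) * rootReflection (b i) =
        (rootReflection (b i) * rootReflection (b j))⁻¹ := by
      rw [mul_inv_rev, inv_eq_of_mul_eq_one_left (rootReflection_mul_self (b i)),
        inv_eq_of_mul_eq_one_left (rootReflection_mul_self (b j))]
    rw [M.symmetric j i, e, inv_pow] at h
    calc ((rootReflection (b i) * rootReflection (b j)) ^ M i j) (b j)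
        = ((rootReflection (b i) * rootReflection (b j)) ^ M i j)
            ((((rootReflection (b i) * rootReflection (b j)) ^ M i j)⁻¹) (b j)) := by rw [h]
      _ = b j := ((rootReflection (b i) * rootReflection (b j)) ^ M i j).apply_symm_apply _
  have h3 : ∀ z : V, inner ℝ z (b i) = (0 : ℝ) → inner ℝ z (b j) = (0 : ℝ) →
      ∀ k, ((rootReflection (b i) * rootReflection (b j)) ^ k) z = z := by
    intro z hi hj k
    induction k with
    | zero => rfl
    | succ k ih =>
      rw [pow_succ]
      change ((rootReflection (b i) * rootReflection (b j)) ^ k)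
        (rootReflection (b i) (rootReflection (b j) z)) = z
      rw [hb.refl_apply j, hj, mul_zero, zero_smul, sub_zero, hb.refl_apply i, hi, mul_zero,
        zero_smul, sub_zero, ih]
  ext v
  have : FiniteDimensional ℝ (Submodule.span ℝ {b i, b j}) :=
    FiniteDimensional.span_of_finite ℝ (Set.toFinite _)
  obtain ⟨y, hy, z, hz, rfl⟩ :=
    (Submodule.span ℝ {b i, b j}).exists_add_mem_mem_orthogonal v
  rw [Submodule.mem_orthogonal'] at hz
  obtain ⟨r, s, rfl⟩ := Submodule.mem_span_pair.1 hy
  rw [map_add, map_add, map_smul, map_smul, h1, h2,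
    h3 z (hz _ (Submodule.subset_span (by simp))) (hz _ (Submodule.subset_span (by simp)))]
  rfl

/-- The geometric representation of the Coxeter group. -/
noncomputable def rep (hb : IsGeometricBasis M b) : M.Group →* (V ≃ₗᵢ[ℝ] V) :=
  M.toCoxeterSystem.lift ⟨_, hb.isLiftable⟩

theorem rep_simple (hb : IsGeometricBasis M b) (i : ι) :
    hb.rep (M.toCoxeterSystem.simple i) = rootReflection (b i) :=
  CoxeterSystem.lift_apply_simple _ hb.isLiftable i

theorem rep_wordProd (hb : IsGeometricBasis M b) (l : List ι) :
    hb.rep (M.toCoxeterSystem.wordProd l) = (l.map fun i => rootReflection (b i)).prod := by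
  rw [CoxeterSystem.wordProd, map_list_prod, List.map_map]
  congr 2

open CoxeterSystem in
/-- If `w sᵢ` is longer than `w`, then `w` sends the simple root `i` to a positive root. -/
theorem repr_rep_nonneg (hb : IsGeometricBasis M b) (w : M.Group) (i : ι)
    (h : M.toCoxeterSystem.length w < M.toCoxeterSystem.length (w * M.toCoxeterSystem.simple i))
    (k : ι) : 0 ≤ b.repr (hb.rep w (b i)) k := by
  classical
  induction hn : M.toCoxeterSystem.length w using Nat.strong_induction_on generalizing w i with
  | _ n ih =>
  set cs := M.toCoxeterSystem with hcs
  rcases eq_or_ne w 1 with rfl | hw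
  · simp only [map_one, LinearIsometryEquiv.coe_one, id, b.repr_self]
    exact Finsupp.single_nonneg.2 zero_le_one k
  obtain ⟨j, hj⟩ := cs.exists_rightDescent_of_ne_one hw
  have hij : i ≠ j := by
    rintro rfl
    exact absurd hj (not_lt.2 h.le)
  -- Split off from w the longest alternating tail in s_i, s_j compatible with lengths: w = v ·
  -- tail, with ℓ(v) + K = ℓ(w).
  set P : ℕ → Prop := fun k => ∃ v, w = v * cs.wordProd (alternatingWord i j k) ∧
    cs.length v + k = cs.length w with hP
  have hP1 : P 1 := by
    refine ⟨w * cs.simple j, by simp [alternatingWord], ?_⟩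
    rw [cs.isRightDescent_iff] at hj
    exact hj
  have hw1 : 1 ≤ cs.length w := by
    rw [Nat.one_le_iff_ne_zero, Ne, cs.length_eq_zero_iff]
    exact hw
  set K := Nat.findGreatest P (cs.length w) with hK
  have hPK : P K := Nat.findGreatest_spec hw1 hP1
  have hK1 : 1 ≤ K := Nat.le_findGreatest hw1 hP1
  have hPK' : ¬ P (K + 1) := by
    intro hp
    have h1 : K + 1 ≤ cs.length w := by
      obtain ⟨v, -, hv⟩ := hp
      omega
    have := Nat.le_findGreatest h1 hp
    omega
  obtain ⟨v, hwv, hlen⟩ := hPK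
  -- A descent of v at this letter would extend the tail, against the maximality of K.
  have hup1 : cs.length v < cs.length (v * cs.simple (if Even K then j else i)) := by
    by_contra hcon
    refine hPK' ⟨v * cs.simple (if Even K then j else i), ?_, ?_⟩
    · rw [alternatingWord_succ', cs.wordProd_cons, ← mul_assoc, cs.simple_mul_simple_cancel_right,
        hwv]
    · rcases cs.length_mul_simple v (if Even K then j else i) with h' | h' <;> omega
  -- This letter is the first of the tail; a descent of v there would cancel it and write w with too
  -- few letters.
  have hup2 : cs.length v < cs.length (v * cs.simple (if Even K then i else j)) := by
    obtain ⟨K', hK'⟩ : ∃ K', K = K' + 1 := ⟨K - 1, by omega⟩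
    have e : (if Even K then i else j) = (if Even K' then j else i) := by
      rw [hK']
      by_cases hE : Even K' <;> simp [Nat.even_add_one, hE]
    by_contra hcon
    have hw' : w = v * cs.simple (if Even K then i else j) *
        cs.wordProd (alternatingWord i j K') := by
      rw [hwv, hK', alternatingWord_succ', cs.wordProd_cons, ← hK', e, mul_assoc]
    have h1 := cs.length_mul_le (v * cs.simple (if Even K then i else j))
      (cs.wordProd (alternatingWord i j K'))
    have h2 := cs.length_wordProd_le (alternatingWord i j K')
    rw [length_alternatingWord] at h2
    rw [← hw'] at h1
    rcases cs.length_mul_simple v (if Even K then i else j) with h' | h' <;> omega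
  -- As w s_i is longer than w, the tail followed by s_i is a reduced alternating word of length K +
  -- 1, which cannot exceed m.
  have hKM : K + 1 ≤ M i j := by
    by_contra hcon
    have hMne : M j i ≠ 0 := hb.ne_zero j i
    have hred := cs.not_isReduced_alternatingWord j i (m := K + 1) hMne
      (by have := M.symmetric i j; show M j i < K + 1; omega)
    apply hred
    have h1 : w * cs.simple i = v * cs.wordProd (alternatingWord j i (K + 1)) := by
      rw [alternatingWord_succ, cs.wordProd_concat, hwv, mul_assoc]
    have h2 := cs.length_mul_le v (cs.wordProd (alternatingWord j i (K + 1)))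
    rw [← h1] at h2
    have h3 := cs.length_wordProd_le (alternatingWord j i (K + 1))
    rw [length_alternatingWord] at h3
    rw [CoxeterSystem.IsReduced, length_alternatingWord]
    omega
  -- For l ≤ m the angle lπ/m stays in [0, π], so the tail sends `b i` to a nonnegative combination
  -- of `b i` and `b j`; the induction hypothesis for v applies to both.
  have hpos : ∀ l : ℕ, l ≤ M i j → 0 ≤ sin (l * (π / (M i j : ℝ))) / sin (π / (M i j : ℝ)) := by
    intro l hl
    have hM0 : (0 : ℝ) < M i j := by exact_mod_cast Nat.pos_of_ne_zero (hb.ne_zero i j)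
    refine div_nonneg (sin_nonneg_of_nonneg_of_le_pi (by positivity) ?_) (hb.sin_pos hij).le
    calc (l : ℝ) * (π / (M i j : ℝ)) ≤ M i j * (π / (M i j : ℝ)) := by gcongr
      _ = π := by field_simp
  have e : hb.rep w (b i) = hb.rep v (hb.rep (cs.wordProd (alternatingWord i j K)) (b i)) := by
    conv_lhs => rw [hwv, map_mul]
    rfl
  have c1 := hpos K (by omega)
  have c2 := hpos (K + 1) hKM
  push_cast at c2
  have hvn : cs.length v < n := by omega
  rw [e, hb.rep_wordProd, hb.prod_alternatingWord_apply hij, map_add, map_smul, map_smul, map_add,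
    map_smul, map_smul]
  exact add_nonneg (mul_nonneg c2 (ih _ hvn v _ hup2 rfl))
    (mul_nonneg c1 (ih _ hvn v _ hup1 rfl))

/-- Here w s_i is shorter than w, so the root lemma applies to it, and s_i negates `b i`. -/
theorem repr_rep_nonpos (hb : IsGeometricBasis M b) (w : M.Group) (i : ι)
    (h : M.toCoxeterSystem.IsRightDescent w i) (k : ι) : b.repr (hb.rep w (b i)) k ≤ 0 := by
  have h1 := hb.repr_rep_nonneg (w * M.toCoxeterSystem.simple i) i (by
    rw [CoxeterSystem.simple_mul_simple_cancel_right]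
    exact h) k
  have h2 : hb.rep (w * M.toCoxeterSystem.simple i) (b i) = -hb.rep w (b i) := by
    rw [map_mul, rep_simple]
    change hb.rep w (rootReflection (b i) (b i)) = _
    rw [hb.refl_apply, hb.inner_self, ← map_neg]
    congr 1
    module
  rw [h2] at h1
  simpa using h1

end IsGeometricBasis

end GeometricRepresentation

/-! ### Dominant vectors and finiteness -/

section Dominant

variable {ι V : Type*} [NormedAddCommGroup V] [InnerProductSpace ℝ V]

/-- A vector is dominant when its inner products with the simple roots are nonnegative. -/
def IsDominant (b : ι → V) (x : V) : Prop := ∀ i, (0 : ℝ) ≤ inner ℝ x (b i)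

/-- The group generated by the reflections in the simple roots with index in `J`. -/
noncomputable def parabolicSubgroup (b : ι → V) (J : Set ι) : Subgroup (V ≃ₗᵢ[ℝ] V) :=
  Subgroup.closure ((fun i => rootReflection (b i)) '' J)

theorem rootReflection_mem_parabolicSubgroup (b : ι → V) {J : Set ι} {i : ι} (hi : i ∈ J) :
    rootReflection (b i) ∈ parabolicSubgroup b J :=
  Subgroup.subset_closure ⟨i, hi, rfl⟩

theorem parabolicSubgroup_univ (b : ι → V) : parabolicSubgroup b Set.univ = reflectionGroup b := by
  rw [parabolicSubgroup, Set.image_univ, reflectionGroup]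

theorem parabolicSubgroup_le (b : ι → V) (J : Set ι) :
    parabolicSubgroup b J ≤ reflectionGroup b := by
  rw [← parabolicSubgroup_univ]
  exact Subgroup.closure_mono (Set.image_mono (Set.subset_univ J))

theorem rootReflection_mem_reflectionGroup (b : ι → V) (i : ι) :
    rootReflection (b i) ∈ reflectionGroup b :=
  Subgroup.subset_closure ⟨i, rfl⟩

/-- A property of vectors that is preserved by the generating reflections is preserved by the
group. -/
theorem parabolicSubgroup_induction {b : ι → V} {J : Set ι} {p : V → Prop}
    (h : ∀ i ∈ J, ∀ v, p v → p (rootReflection (b i) v)) {g : V ≃ₗᵢ[ℝ] V}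
    (hg : g ∈ parabolicSubgroup b J) {v : V} (hv : p v) : p (g v) := by
  induction hg using Subgroup.closure_induction'' generalizing v with
  | mem x hx =>
    obtain ⟨i, hi, rfl⟩ := hx
    exact h i hi v hv
  | inv_mem x hx =>
    obtain ⟨i, hi, rfl⟩ := hx
    rw [inv_eq_of_mul_eq_one_left (rootReflection_mul_self (b i))]
    exact h i hi v hv
  | one => exact hv
  | mul x y _ _ hx hy => exact hx (hy hv)

theorem inner_nonneg_of_isDominant [Fintype ι] {b : Module.Basis ι ℝ V} {c v : V}
    (hc : IsDominant b c) (hv : ∀ k, 0 ≤ b.repr v k) : (0 : ℝ) ≤ inner ℝ v c := by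
  rw [← b.sum_repr v, sum_inner]
  refine Finset.sum_nonneg fun i _ => ?_
  rw [real_inner_smul_left, real_inner_comm]
  exact mul_nonneg (hv i) (hc i)

/-- Riesz representation; it supplies fundamental weights, the vector ρ with all products 1, and
normals to prescribed faces. -/
theorem exists_inner_basis_eq [Fintype ι] (b : Module.Basis ι ℝ V) (f : ι → ℝ) :
    ∃ c : V, ∀ i, inner ℝ c (b i) = f i := by
  have : FiniteDimensional ℝ V := b.finiteDimensional_of_finite
  have : CompleteSpace V := FiniteDimensional.complete ℝ V
  refine ⟨(InnerProductSpace.toDual ℝ V).symm (b.constr ℝ f).toContinuousLinearMap, fun i => ?_⟩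
  rw [InnerProductSpace.toDual_symm_apply, LinearMap.coe_toContinuousLinearMap', b.constr_basis]

namespace IsGeometricBasis

variable {M : CoxeterMatrix ι} {b : Module.Basis ι ℝ V}

theorem exists_rep_eq (hb : IsGeometricBasis M b) {g : V ≃ₗᵢ[ℝ] V} (hg : g ∈ reflectionGroup b) :
    ∃ w, hb.rep w = g := by
  have h : reflectionGroup b ≤ hb.rep.range := by
    rw [reflectionGroup, Subgroup.closure_le]
    rintro _ ⟨i, rfl⟩
    exact ⟨_, hb.rep_simple i⟩
  exact h hg

/-- Telescoping along a reduced word: each step from v to v s_i adds 2⟨x, `b i`⟩ times the positive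
root v(`b i`). -/
theorem repr_sub_rep_nonneg (hb : IsGeometricBasis M b) {x : V} (hx : IsDominant b x)
    (w : M.Group) (k : ι) : 0 ≤ b.repr (x - hb.rep w x) k := by
  set cs := M.toCoxeterSystem with hcs
  induction hn : cs.length w using Nat.strong_induction_on generalizing w with
  | _ n ih =>
  rcases eq_or_ne w 1 with rfl | hw
  · simp
  obtain ⟨i, hi⟩ := cs.exists_rightDescent_of_ne_one hw
  obtain ⟨v, rfl⟩ : ∃ v, w = v * cs.simple i := ⟨w * cs.simple i, by simp⟩
  rw [cs.isRightDescent_iff, cs.simple_mul_simple_cancel_right] at hi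
  have e : x - hb.rep (v * cs.simple i) x =
      (x - hb.rep v x) + (2 * inner ℝ x (b i)) • hb.rep v (b i) := by
    rw [map_mul, hb.rep_simple, isometry_mul_apply, hb.refl_apply, map_sub, map_smul]
    abel
  rw [e, map_add, map_smul]
  refine add_nonneg (ih _ (by omega) v rfl) (mul_nonneg (mul_nonneg zero_le_two (hx i)) ?_)
  exact hb.repr_rep_nonneg v i (by rw [← hcs]; omega) k

theorem repr_sub_nonneg (hb : IsGeometricBasis M b) {x : V} (hx : IsDominant b x)
    {g : V ≃ₗᵢ[ℝ] V} (hg : g ∈ reflectionGroup b) (k : ι) : 0 ≤ b.repr (x - g x) k := by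
  obtain ⟨w, rfl⟩ := hb.exists_rep_eq hg
  exact hb.repr_sub_rep_nonneg hx w k

/-- An orbit contains at most one dominant vector. -/
theorem eq_of_isDominant (hb : IsGeometricBasis M b) {x : V} (hx : IsDominant b x)
    {g : V ≃ₗᵢ[ℝ] V} (hg : g ∈ reflectionGroup b) (hgx : IsDominant b (g x)) : g x = x := by
  have h1 := hb.repr_sub_nonneg hx hg
  have h2 := hb.repr_sub_nonneg hgx (inv_mem hg)
  have h3 : g⁻¹ (g x) = x := g.symm_apply_apply x
  rw [h3] at h2
  apply b.repr.injective
  ext k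
  have h1 := h1 k
  have h2 := h2 k
  simp only [map_sub, Finsupp.coe_sub, Pi.sub_apply] at h1 h2
  linarith

/-- At a right descent i of g the root g(`b i`) is negative: its product with gρ is 1 and with ρ at
most 0. So the orbit of ρ is 1-separated and its stabiliser is trivial. -/
theorem one_le_norm_sub (hb : IsGeometricBasis M b) [Fintype ι] {ρ : V}
    (hρ : ∀ i, inner ℝ ρ (b i) = (1 : ℝ)) {g : V ≃ₗᵢ[ℝ] V} (hg : g ∈ reflectionGroup b)
    (hg1 : g ≠ 1) : 1 ≤ ‖g ρ - ρ‖ := by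
  obtain ⟨w, rfl⟩ := hb.exists_rep_eq hg
  have hw : w ≠ 1 := by
    rintro rfl
    exact hg1 (map_one _)
  obtain ⟨i, hi⟩ := M.toCoxeterSystem.exists_rightDescent_of_ne_one hw
  have h1 : inner ℝ (hb.rep w ρ) (hb.rep w (b i)) = (1 : ℝ) := by
    rw [LinearIsometryEquiv.inner_map_map, hρ]
  have h2 : inner ℝ ρ (hb.rep w (b i)) ≤ (0 : ℝ) := by
    have := inner_nonneg_of_isDominant (b := b) (c := ρ) (v := -hb.rep w (b i))
      (fun j => by rw [hρ]; exact zero_le_one)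
      (fun k => by simpa using hb.repr_rep_nonpos w i hi k)
    rw [inner_neg_left, real_inner_comm] at this
    linarith
  calc (1 : ℝ) ≤ inner ℝ (hb.rep w ρ - ρ) (hb.rep w (b i)) := by
        rw [inner_sub_left, h1]
        linarith
    _ ≤ ‖hb.rep w ρ - ρ‖ * ‖hb.rep w (b i)‖ := real_inner_le_norm _ _
    _ = ‖hb.rep w ρ - ρ‖ := by rw [LinearIsometryEquiv.norm_map, hb.norm_eq_one, mul_one]

/-- The orbit of ρ is 1-separated in a compact ball; a ball of radius 1/2 of a finite cover meets it
for at most one group element. -/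
theorem finite_reflectionGroup (hb : IsGeometricBasis M b) [Fintype ι] :
    Finite (reflectionGroup b) := by
  have : FiniteDimensional ℝ V := b.finiteDimensional_of_finite
  obtain ⟨ρ, hρ⟩ := exists_inner_basis_eq b fun _ => 1
  have htb := (isCompact_closedBall (0 : V) ‖ρ‖).totallyBounded
  obtain ⟨t, ht, hcov⟩ := Metric.totallyBounded_iff.1 htb (1 / 2) (by norm_num)
  have hc : ∀ g : reflectionGroup b, ∃ y : t, dist ((g : V ≃ₗᵢ[ℝ] V) ρ) y < 1 / 2 := by
    intro g
    have hmem : (g : V ≃ₗᵢ[ℝ] V) ρ ∈ Metric.closedBall (0 : V) ‖ρ‖ := by simp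
    obtain ⟨y, hy, hd⟩ := Set.mem_iUnion₂.1 (hcov hmem)
    exact ⟨⟨y, hy⟩, hd⟩
  choose f hf using hc
  have : Finite t := ht
  refine Finite.of_injective f fun g h hgh => ?_
  by_contra hne
  have h1 := hb.one_le_norm_sub hρ (h⁻¹ * g).2 (by
    intro h'
    apply hne
    have : h⁻¹ * g = 1 := Subtype.ext h'
    exact (inv_mul_eq_one.1 this).symm)
  have h2 : ‖((h⁻¹ * g : reflectionGroup b) : V ≃ₗᵢ[ℝ] V) ρ - ρ‖ =
      dist ((g : V ≃ₗᵢ[ℝ] V) ρ) ((h : V ≃ₗᵢ[ℝ] V) ρ) := by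
    rw [dist_eq_norm, ← LinearIsometryEquiv.norm_map (h : V ≃ₗᵢ[ℝ] V), map_sub]
    congr 2
    exact (h : V ≃ₗᵢ[ℝ] V).apply_symm_apply _
  have h3 := dist_triangle_right ((g : V ≃ₗᵢ[ℝ] V) ρ) ((h : V ≃ₗᵢ[ℝ] V) ρ) (f g)
  have h4 := hf g
  have h5 := hf h
  rw [← hgh] at h5
  linarith

theorem finite_parabolicSubgroup (hb : IsGeometricBasis M b) [Fintype ι] (J : Set ι) :
    Finite (parabolicSubgroup b J) :=
  have := hb.finite_reflectionGroup
  Finite.of_injective (Subgroup.inclusion (parabolicSubgroup_le b J))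
    (Subgroup.inclusion_injective _)

/-- Maximise ⟨gy, ρ⟩ over the finite group: a negative product with some `b j` could be reflected
away, increasing the maximum. -/
theorem exists_parabolic_dominant (hb : IsGeometricBasis M b) [Fintype ι] (J : Set ι) (y : V) :
    ∃ g ∈ parabolicSubgroup b J, ∀ j ∈ J, (0 : ℝ) ≤ inner ℝ (g y) (b j) := by
  obtain ⟨ρ, hρ⟩ := exists_inner_basis_eq b fun _ => 1
  have := hb.finite_parabolicSubgroup J
  obtain ⟨g, hg⟩ := Finite.exists_max
    fun g : parabolicSubgroup b J => (inner ℝ ((g : V ≃ₗᵢ[ℝ] V) y) ρ : ℝ)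
  refine ⟨g, g.2, fun j hj => ?_⟩
  have h := hg (⟨_, rootReflection_mem_parabolicSubgroup b hj⟩ * g)
  simp only [Subgroup.coe_mul, isometry_mul_apply] at h
  rw [hb.refl_apply, inner_sub_left, real_inner_smul_left, real_inner_comm ρ (b j), hρ] at h
  linarith

theorem exists_isDominant (hb : IsGeometricBasis M b) [Fintype ι] (y : V) :
    ∃ g ∈ reflectionGroup b, IsDominant b (g y) := by
  obtain ⟨g, hg, h⟩ := hb.exists_parabolic_dominant Set.univ y
  exact ⟨g, parabolicSubgroup_univ b ▸ hg, fun i => h i trivial⟩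

theorem sub_mem_span (hb : IsGeometricBasis M b) {J : Set ι} {g : V ≃ₗᵢ[ℝ] V}
    (hg : g ∈ parabolicSubgroup b J) (x : V) : x - g x ∈ Submodule.span ℝ (b '' J) := by
  refine parabolicSubgroup_induction (p := fun v => x - v ∈ Submodule.span ℝ (b '' J))
    (fun i hi v hv => ?_) hg (by simp)
  have e : x - rootReflection (b i) v = (x - v) + (2 * inner ℝ v (b i)) • b i := by
    rw [hb.refl_apply]
    abel
  rw [e]
  exact add_mem hv (Submodule.smul_mem _ _ (Submodule.subset_span ⟨i, hi, rfl⟩))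

end IsGeometricBasis

end Dominant

/-! ### Faces of orbit polytopes -/

section Faces

variable {ι V : Type*} [NormedAddCommGroup V] [InnerProductSpace ℝ V]

theorem mem_orbitPolytope {W : Subgroup (V ≃ₗᵢ[ℝ] V)} {g : V ≃ₗᵢ[ℝ] V} (hg : g ∈ W) (x : V) :
    g x ∈ orbitPolytope W x :=
  subset_convexHull ℝ _ ⟨g, hg, rfl⟩

theorem self_mem_orbitPolytope (W : Subgroup (V ≃ₗᵢ[ℝ] V)) (x : V) : x ∈ orbitPolytope W x :=
  mem_orbitPolytope (one_mem W) x

/-- Allows the generating point to be taken dominant. -/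
theorem orbitPolytope_apply {W : Subgroup (V ≃ₗᵢ[ℝ] V)} {g : V ≃ₗᵢ[ℝ] V} (hg : g ∈ W) (x : V) :
    orbitPolytope W (g x) = orbitPolytope W x := by
  unfold orbitPolytope
  congr 1
  ext y
  constructor
  · rintro ⟨w, hw, rfl⟩
    exact ⟨w * g, mul_mem hw hg, rfl⟩
  · rintro ⟨w, hw, rfl⟩
    refine ⟨w * g⁻¹, mul_mem hw (inv_mem hg), ?_⟩
    rw [isometry_mul_apply]
    congr 1
    exact (g.symm_apply_apply x).symm

theorem image_orbitPolytope {W : Subgroup (V ≃ₗᵢ[ℝ] V)} {g : V ≃ₗᵢ[ℝ] V} (hg : g ∈ W) (x : V) :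
    g '' orbitPolytope W x = orbitPolytope W x := by
  have h := (g.toLinearEquiv : V →ₗ[ℝ] V).image_convexHull {y | ∃ w ∈ W, y = w x}
  change g '' _ = _ at h
  unfold orbitPolytope
  rw [h]
  congr 1
  ext y
  constructor
  · rintro ⟨_, ⟨w, hw, rfl⟩, rfl⟩
    exact ⟨g * w, mul_mem hg hw, rfl⟩
  · rintro ⟨w, hw, rfl⟩
    exact ⟨g⁻¹ (w x), ⟨g⁻¹ * w, mul_mem (inv_mem hg) hw, rfl⟩, g.apply_symm_apply _⟩

/-- The points of a convex hull at which a linear functional attains its largest value. -/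
theorem convexHull_inter_eq {l : V →ₗ[ℝ] ℝ} {S : Set V} {m : ℝ} (hS : ∀ y ∈ S, l y ≤ m) :
    {z ∈ convexHull ℝ S | l z = m} = convexHull ℝ {y ∈ S | l y = m} := by
  apply Set.Subset.antisymm
  · have hsub : convexHull ℝ S ⊆
        {z | l z ≤ m ∧ (l z = m → z ∈ convexHull ℝ {y ∈ S | l y = m})} := by
      refine convexHull_min (fun y hy => ⟨hS y hy, fun h => subset_convexHull ℝ _ ⟨hy, h⟩⟩) ?_
      rintro y ⟨hy, hy'⟩ z ⟨hz, hz'⟩ r s hr hs hrs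
      have e : l (r • y + s • z) = r * l y + s * l z := by simp
      have hle : r * l y + s * l z ≤ m := by
        calc r * l y + s * l z ≤ r * m + s * m := by gcongr
          _ = m := by rw [← add_mul, hrs, one_mul]
      refine ⟨e ▸ hle, fun h => ?_⟩
      rw [e] at h
      have hm : r * m + s * m = m := by rw [← add_mul, hrs, one_mul]
      have h1 : r * (m - l y) = 0 := by
        nlinarith [mul_nonneg hr (sub_nonneg.2 hy), mul_nonneg hs (sub_nonneg.2 hz)]
      have h2 : s * (m - l z) = 0 := by
        nlinarith [mul_nonneg hr (sub_nonneg.2 hy), mul_nonneg hs (sub_nonneg.2 hz)]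
      rcases mul_eq_zero.1 h1 with rfl | h1
      · have : s = 1 := by linarith
        subst this
        simpa using hz' (by linarith)
      rcases mul_eq_zero.1 h2 with rfl | h2
      · have : r = 1 := by linarith
        subst this
        simpa using hy' (by linarith)
      exact convex_convexHull ℝ _ (hy' (by linarith)) (hz' (by linarith)) hr hs hrs
    exact fun z hz => (hsub hz.1).2 hz.2
  · refine convexHull_min (fun y hy => ⟨subset_convexHull ℝ _ hy.1, hy.2⟩) ?_
    exact (convex_convexHull ℝ S).inter (convex_hyperplane l.isLinear m)

theorem finrank_span_basis_image (b : Module.Basis ι ℝ V) (J : Finset ι) :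
    Module.finrank ℝ (Submodule.span ℝ (b '' (J : Set ι))) = J.card := by
  rw [Set.image_eq_range]
  have h := finrank_span_eq_card (R := ℝ) (b := fun j : (J : Set ι) => b j)
    (b.linearIndependent.comp _ Subtype.val_injective)
  rw [h]
  simp

/-- Sets of nodes that are built up from the empty set by adding, one at a time, nodes that are
linked to an earlier node or whose mirror does not contain `x`. -/
inductive IsGrown [DecidableEq ι] (b : ι → V) (x : V) : Finset ι → Prop
  | empty : IsGrown b x ∅
  | insert (j : ι) (J : Finset ι) (hj : j ∉ J) (hJ : IsGrown b x J)
      (h : inner ℝ x (b j) ≠ (0 : ℝ) ∨ ∃ k ∈ J, inner ℝ (b k) (b j) ≠ (0 : ℝ)) :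
      IsGrown b x (insert j J)

namespace IsGeometricBasis

variable {M : CoxeterMatrix ι} {b : Module.Basis ι ℝ V}

theorem inner_apply_eq_of_mem_parabolic (hb : IsGeometricBasis M b) {J : Set ι} {c : V}
    (hc : ∀ i ∈ J, inner ℝ c (b i) = (0 : ℝ)) {g : V ≃ₗᵢ[ℝ] V} (hg : g ∈ parabolicSubgroup b J)
    (v : V) : inner ℝ c (g v) = (inner ℝ c v : ℝ) := by
  refine parabolicSubgroup_induction (p := fun u => inner ℝ c u = (inner ℝ c v : ℝ))
    (fun i hi u hu => ?_) hg rfl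
  rw [hb.refl_apply, inner_sub_right, real_inner_smul_right, hc i hi, hu]
  simp

theorem inner_apply_le (hb : IsGeometricBasis M b) [Fintype ι] {x c : V} (hx : IsDominant b x)
    (hc : IsDominant b c) {g : V ≃ₗᵢ[ℝ] V} (hg : g ∈ reflectionGroup b) :
    inner ℝ c (g x) ≤ (inner ℝ c x : ℝ) := by
  have h := inner_nonneg_of_isDominant hc (hb.repr_sub_nonneg hx hg)
  rw [real_inner_comm, inner_sub_right] at h
  linarith

/-- Elements of W_J preserve ⟨c, ·⟩ and can make g x dominant for J. For i outside J a negative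
product with `b i` is impossible, since reflecting would push ⟨c, ·⟩ beyond its maximum ⟨c, x⟩. The
resulting vector is dominant, hence equal to x. -/
theorem exists_parabolic_of_inner_eq (hb : IsGeometricBasis M b) [Fintype ι] {x c : V}
    (hx : IsDominant b x) (hc : IsDominant b c) {J : Set ι}
    (hJ : ∀ i, i ∈ J ↔ inner ℝ c (b i) = (0 : ℝ)) {g : V ≃ₗᵢ[ℝ] V} (hg : g ∈ reflectionGroup b)
    (h : inner ℝ c (g x) = (inner ℝ c x : ℝ)) : ∃ w ∈ parabolicSubgroup b J, g x = w x := by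
  obtain ⟨w, hw, hdom⟩ := hb.exists_parabolic_dominant J (g x)
  have hwg : w * g ∈ reflectionGroup b := mul_mem (parabolicSubgroup_le b J hw) hg
  have hcw : inner ℝ c (w (g x)) = (inner ℝ c x : ℝ) := by
    rw [hb.inner_apply_eq_of_mem_parabolic (fun i hi => (hJ i).1 hi) hw, h]
  have hdom' : IsDominant b ((w * g) x) := by
    intro i
    by_cases hi : i ∈ J
    · exact hdom i hi
    · have hci : (0 : ℝ) < inner ℝ c (b i) := lt_of_le_of_ne (hc i) fun h => hi ((hJ i).2 h.symm)
      have hle := hb.inner_apply_le hx hc (mul_mem (rootReflection_mem_reflectionGroup b i) hwg)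
      rw [isometry_mul_apply, isometry_mul_apply, hb.refl_apply, inner_sub_right,
        real_inner_smul_right, hcw] at hle
      rw [isometry_mul_apply]
      by_contra hneg
      push Not at hneg
      nlinarith [mul_pos_of_neg_of_neg hneg (neg_neg_of_pos hci)]
  have heq := hb.eq_of_isDominant hx hwg hdom'
  refine ⟨w⁻¹, inv_mem hw, ?_⟩
  conv_rhs => rw [← heq]
  exact (w.symm_apply_apply _).symm

/-- The face of an orbit polytope in a dominant direction is an orbit polytope of a parabolic
subgroup. -/
theorem face_eq (hb : IsGeometricBasis M b) [Fintype ι] {x c : V}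
    (hx : IsDominant b x) (hc : IsDominant b c) {J : Set ι}
    (hJ : ∀ i, i ∈ J ↔ inner ℝ c (b i) = (0 : ℝ)) :
    {z ∈ orbitPolytope (reflectionGroup b) x |
      ∀ y ∈ orbitPolytope (reflectionGroup b) x, inner ℝ c y ≤ (inner ℝ c z : ℝ)} =
      orbitPolytope (parabolicSubgroup b J) x := by
  have hS : ∀ y ∈ {y | ∃ w ∈ reflectionGroup b, y = w x}, innerₛₗ ℝ c y ≤ inner ℝ c x := by
    rintro y ⟨w, hw, rfl⟩
    exact hb.inner_apply_le hx hc hw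
  have h1 := convexHull_inter_eq hS
  have h2 : {y ∈ {y | ∃ w ∈ reflectionGroup b, y = w x} | innerₛₗ ℝ c y = inner ℝ c x} =
      {y | ∃ w ∈ parabolicSubgroup b J, y = w x} := by
    ext y
    constructor
    · rintro ⟨⟨w, hw, rfl⟩, h⟩
      exact hb.exists_parabolic_of_inner_eq hx hc hJ hw h
    · rintro ⟨w, hw, rfl⟩
      exact ⟨⟨w, parabolicSubgroup_le b J hw, rfl⟩,
        hb.inner_apply_eq_of_mem_parabolic (fun i hi => (hJ i).1 hi) hw x⟩
  have hP : ∀ y ∈ orbitPolytope (reflectionGroup b) x, inner ℝ c y ≤ (inner ℝ c x : ℝ) :=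
    fun y hy => convexHull_min hS (convex_halfSpace_le (innerₛₗ ℝ c).isLinear _) hy
  rw [h2] at h1
  rw [orbitPolytope, orbitPolytope, ← h1]
  ext z
  constructor
  · rintro ⟨hz, h⟩
    exact ⟨hz, le_antisymm (hP z hz) (h x (self_mem_orbitPolytope _ x))⟩
  · rintro ⟨hz, h⟩
    refine ⟨hz, fun y hy => ?_⟩
    change inner ℝ c z = (inner ℝ c x : ℝ) at h
    rw [h]
    exact hP y hy

theorem isExposed_parabolic (hb : IsGeometricBasis M b) [Fintype ι] {x : V}
    (hx : IsDominant b x) (J : Set ι) :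
    IsExposed ℝ (orbitPolytope (reflectionGroup b) x)
      (orbitPolytope (parabolicSubgroup b J) x) := by
  classical
  intro _
  obtain ⟨c, hc⟩ := exists_inner_basis_eq b fun i => if i ∈ J then 0 else 1
  have hJ : ∀ i, i ∈ J ↔ inner ℝ c (b i) = (0 : ℝ) := fun i => by
    rw [hc]
    by_cases h : i ∈ J <;> simp [h]
  have hcd : IsDominant b c := fun i => by
    rw [hc]
    split_ifs <;> norm_num
  exact ⟨innerSL ℝ c, (hb.face_eq hx hcd hJ).symm⟩

theorem sub_mem_span_of_mem_orbitPolytope (hb : IsGeometricBasis M b) {x y : V} {J : Set ι}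
    (hy : y ∈ orbitPolytope (parabolicSubgroup b J) x) :
    x - y ∈ Submodule.span ℝ (b '' J) := by
  refine convexHull_min (t := {y | x - y ∈ Submodule.span ℝ (b '' J)}) ?_ ?_ hy
  · rintro _ ⟨w, hw, rfl⟩
    exact hb.sub_mem_span hw x
  · intro y hy z hz r s _ _ hrs
    have e : x - (r • y + s • z) = r • (x - y) + s • (x - z) := by
      have : x = (r + s) • x := by rw [hrs, one_smul]
      conv_lhs => rw [this]
      module
    change x - (r • y + s • z) ∈ Submodule.span ℝ (b '' J)
    rw [e]
    exact add_mem (Submodule.smul_mem _ _ hy) (Submodule.smul_mem _ _ hz)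

theorem repr_sub_nonneg_of_mem_orbitPolytope (hb : IsGeometricBasis M b) {x y : V}
    (hx : IsDominant b x) (hy : y ∈ orbitPolytope (reflectionGroup b) x) (k : ι) :
    0 ≤ b.repr (x - y) k := by
  refine convexHull_min (t := {y | 0 ≤ b.repr (x - y) k}) ?_ ?_ hy
  · rintro _ ⟨w, hw, rfl⟩
    exact hb.repr_sub_nonneg hx hw k
  · intro y hy z hz r s hr hs hrs
    have e : x - (r • y + s • z) = r • (x - y) + s • (x - z) := by
      have : x = (r + s) • x := by rw [hrs, one_smul]
      conv_lhs => rw [this]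
      module
    change 0 ≤ b.repr (x - (r • y + s • z)) k
    rw [e, map_add, map_smul, map_smul]
    exact add_nonneg (mul_nonneg hr hy) (mul_nonneg hs hz)

/-- The directions of the orbit polytope of a parabolic subgroup with grown set of nodes. -/
theorem vectorSpan_orbitPolytope (hb : IsGeometricBasis M b) [DecidableEq ι] {x : V}
    {J : Finset ι} (hJ : IsGrown b x J) :
    vectorSpan ℝ (orbitPolytope (parabolicSubgroup b (J : Set ι)) x) =
      Submodule.span ℝ (b '' (J : Set ι)) := by
  apply le_antisymm
  · rw [vectorSpan, Submodule.span_le]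
    rintro _ ⟨y, hy, z, hz, rfl⟩
    have h1 := hb.sub_mem_span_of_mem_orbitPolytope hy
    have h2 := hb.sub_mem_span_of_mem_orbitPolytope hz
    have e : y -ᵥ z = (x - z) - (x - y) := by
      rw [vsub_eq_sub]
      abel
    change y -ᵥ z ∈ Submodule.span ℝ (b '' (J : Set ι))
    rw [e]
    exact sub_mem h2 h1
  · set U := vectorSpan ℝ (orbitPolytope (parabolicSubgroup b (J : Set ι)) x) with hU
    -- The polytope is W_J-invariant, hence so is its direction space.
    have hstab : ∀ j ∈ J, ∀ u ∈ U, rootReflection (b j) u ∈ U := by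
      intro j hj u hu
      have hmem := rootReflection_mem_parabolicSubgroup b (J := (J : Set ι)) (i := j) (by simpa)
      have h := Submodule.mem_map_of_mem (f := ((rootReflection (b j)).toLinearEquiv : V →ₗ[ℝ] V))
        hu
      have e : U.map ((rootReflection (b j)).toLinearEquiv : V →ₗ[ℝ] V) = U := by
        have h3 := (((rootReflection (b j)).toLinearEquiv :
          V →ₗ[ℝ] V).toAffineMap).map_vectorSpan
          (s := orbitPolytope (parabolicSubgroup b (J : Set ι)) x)
        change Submodule.map _ _ = vectorSpan ℝ (rootReflection (b j) '' _) at h3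
        rw [image_orbitPolytope hmem] at h3
        exact h3
      rw [e] at h
      exact h
    -- Along the growth of K, either s_j x - x or s_j `b k` - `b k` is a nonzero multiple of `b j`
    -- lying in U.
    have key : ∀ K : Finset ι, IsGrown b x K → K ⊆ J → ∀ j ∈ K, b j ∈ U := by
      intro K hK
      induction hK with
      | empty => simp
      | insert j K hj hK h ih =>
        intro hsub
        have ih := ih ((Finset.subset_insert j K).trans hsub)
        have hjJ : j ∈ J := hsub (Finset.mem_insert_self j K)
        have hbj : b j ∈ U := by
          have hcancel : ∀ v : V, inner ℝ v (b j) ≠ (0 : ℝ) → rootReflection (b j) v - v ∈ U →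
              b j ∈ U := by
            intro v hv hmem
            rw [hb.refl_apply, sub_sub_cancel_left, ← neg_smul] at hmem
            exact (Submodule.smul_mem_iff _ (by simpa using hv)).1 hmem
          rcases h with h | ⟨k, hk, h⟩
          · refine hcancel x h (vsub_mem_vectorSpan ℝ (mem_orbitPolytope ?_ x)
              (self_mem_orbitPolytope _ x))
            exact rootReflection_mem_parabolicSubgroup b (by simpa)
          · exact hcancel (b k) h (sub_mem (hstab j hjJ _ (ih k hk)) (ih k hk))
        intro i hi
        rcases Finset.mem_insert.1 hi with rfl | hi
        · exact hbj
        · exact ih i hi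
    rw [Submodule.span_le]
    rintro _ ⟨j, hj, rfl⟩
    exact key J hJ subset_rfl j hj

theorem orbitPolytope_mem_facesOfDim (hb : IsGeometricBasis M b) [Fintype ι] [DecidableEq ι]
    {x : V} (hx : IsDominant b x) {J : Finset ι} (hJ : IsGrown b x J) :
    orbitPolytope (parabolicSubgroup b (J : Set ι)) x ∈
      facesOfDim (orbitPolytope (reflectionGroup b) x) J.card := by
  refine ⟨⟨x, self_mem_orbitPolytope _ x⟩, hb.isExposed_parabolic hx _, ?_⟩
  rw [hb.vectorSpan_orbitPolytope hJ, finrank_span_basis_image]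

/-- The center of the orbit polytope of a parabolic subgroup. -/
theorem exists_center (hb : IsGeometricBasis M b) [Fintype ι] [DecidableEq ι] {x : V}
    (hx : IsDominant b x) {J : Finset ι} (hJ : IsGrown b x J) :
    ∃ p ∈ orbitPolytope (parabolicSubgroup b (J : Set ι)) x, IsDominant b p ∧
      (∀ y ∈ orbitPolytope (parabolicSubgroup b (J : Set ι)) x,
        ‖y‖ ^ 2 = ‖p‖ ^ 2 + ‖y - p‖ ^ 2) ∧
      ∀ k, k ∈ J ↔ b.repr (x - p) k ≠ 0 := by
  set W := parabolicSubgroup b (J : Set ι) with hW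
  have := hb.finite_parabolicSubgroup (J : Set ι)
  have := Fintype.ofFinite W
  -- The barycentre of the W_J-orbit, with multiplicity. It is W_J-fixed, hence orthogonal to the
  -- roots of J and the point of the face nearest the origin.
  set p : V := ∑ g : W, ((Fintype.card W : ℝ)⁻¹) • (g : V ≃ₗᵢ[ℝ] V) x with hp
  have hcard : (Fintype.card W : ℝ) ≠ 0 := by
    exact_mod_cast Fintype.card_ne_zero
  have hpF : p ∈ orbitPolytope W x := by
    refine (convex_convexHull ℝ _).sum_mem (fun _ _ => by positivity) ?_
      fun g _ => mem_orbitPolytope g.2 x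
    simp [hcard]
  have hpW : p ∈ orbitPolytope (reflectionGroup b) x := by
    refine convexHull_mono ?_ hpF
    rintro _ ⟨w, hw, rfl⟩
    exact ⟨w, parabolicSubgroup_le b _ hw, rfl⟩
  have hpJ : ∀ j ∈ J, inner ℝ p (b j) = (0 : ℝ) := by
    intro j hj
    have hr : rootReflection (b j) ∈ W :=
      rootReflection_mem_parabolicSubgroup b (by simpa)
    have h : rootReflection (b j) p = p := by
      rw [hp, map_sum]
      refine Fintype.sum_equiv (Equiv.mulLeft (⟨_, hr⟩ : W)) _ _ fun g => ?_
      rw [map_smul]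
      rfl
    rw [hb.refl_apply, sub_eq_self, smul_eq_zero] at h
    rcases h with h | h
    · linarith
    · exact absurd h (b.ne_zero j)
  have hspan := hb.sub_mem_span_of_mem_orbitPolytope hpF
  have hrepr0 : ∀ k ∉ J, b.repr (x - p) k = 0 := by
    intro k hk
    have h := (b.mem_span_image).1 hspan
    by_contra hne
    exact hk (h (Finsupp.mem_support_iff.2 hne))
  have hnonneg := hb.repr_sub_nonneg_of_mem_orbitPolytope hx hpW
  -- In this expansion the coefficients are nonnegative and the products of distinct roots
  -- nonpositive; both dominance and the support statement are read off from these signs.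
  have hinner : ∀ k, inner ℝ p (b k) =
      inner ℝ x (b k) - ∑ i, b.repr (x - p) i * (inner ℝ (b i) (b k) : ℝ) := by
    intro k
    have e : (∑ i, b.repr (x - p) i * (inner ℝ (b i) (b k) : ℝ)) = inner ℝ (x - p) (b k) := by
      conv_rhs => rw [← b.sum_repr (x - p), sum_inner]
      simp only [real_inner_smul_left]
    rw [e, inner_sub_left]
    ring
  have hterm : ∀ k, b.repr (x - p) k = 0 → ∀ i,
      b.repr (x - p) i * (inner ℝ (b i) (b k) : ℝ) ≤ 0 := by
    intro k hk i
    rcases eq_or_ne i k with rfl | hik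
    · rw [hk, zero_mul]
    · exact mul_nonpos_of_nonneg_of_nonpos (hnonneg i) (hb.inner_nonpos hik)
  have hdom : IsDominant b p := by
    intro k
    by_cases hk : k ∈ J
    · exact (hpJ k hk).ge
    · have h1 := Finset.sum_nonpos fun i (_ : i ∈ Finset.univ) => hterm k (hrepr0 k hk) i
      have h2 := hx k
      rw [hinner]
      linarith
  -- If the coefficient at a node of J vanished, the expansion of 0 = ⟨p, `b i`⟩ would have only
  -- nonnegative contributions, so all vanish. This contradicts the reason for which the node was
  -- added.
  have hpos : ∀ K : Finset ι, IsGrown b x K → K ⊆ J → ∀ j ∈ K, b.repr (x - p) j ≠ 0 := by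
    intro K hK
    induction hK with
    | empty => simp
    | insert j K hj hK h ih =>
      intro hsub
      have ih := ih ((Finset.subset_insert j K).trans hsub)
      intro i hi
      rcases Finset.mem_insert.1 hi with rfl | hi
      · intro hzero
        have h1 := hterm i hzero
        have h2 := Finset.sum_nonpos fun k (_ : k ∈ Finset.univ) => h1 k
        have h3 := hinner i
        rw [hpJ i (hsub (Finset.mem_insert_self i K))] at h3
        have h4 := hx i
        have h5 : ∑ k, b.repr (x - p) k * (inner ℝ (b k) (b i) : ℝ) = 0 := by linarith
        have h6 := (Finset.sum_eq_zero_iff_of_nonpos fun k _ => h1 k).1 h5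
        rcases h with h | ⟨k, hk, h⟩
        · exact h (by linarith)
        · exact mul_ne_zero (ih k hk) h (h6 k (Finset.mem_univ k))
      · exact ih i hi
  refine ⟨p, hpF, hdom, fun y hy => ?_, fun k => ⟨hpos J hJ subset_rfl k, fun h => ?_⟩⟩
  · have hy' : y - p ∈ Submodule.span ℝ (b '' (J : Set ι)) := by
      have e : y - p = (x - p) - (x - y) := by abel
      rw [e]
      exact sub_mem hspan (hb.sub_mem_span_of_mem_orbitPolytope hy)
    have horth : inner ℝ p (y - p) = (0 : ℝ) := by
      refine Submodule.span_induction (p := fun v _ => inner ℝ p v = (0 : ℝ)) ?_ ?_ ?_ ?_ hy'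
      · rintro _ ⟨j, hj, rfl⟩
        exact hpJ j hj
      · exact inner_zero_right p
      · intro u v _ _ hu hv
        rw [inner_add_right, hu, hv, add_zero]
      · intro r v _ hv
        rw [real_inner_smul_right, hv, mul_zero]
    have h := norm_add_sq_real p (y - p)
    rw [horth, add_sub_cancel] at h
    linarith
  · by_contra hk
    exact h (hrepr0 k hk)

/-- An isometry fixing 0 carries the point of least norm to the point of least norm, so the centers
are W-conjugate. Being dominant they coincide, and the support of x minus the center recovers the
node set. -/
theorem eq_of_image_orbitPolytope_eq (hb : IsGeometricBasis M b) [Fintype ι] [DecidableEq ι]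
    {x : V} (hx : IsDominant b x) {J K : Finset ι} (hJ : IsGrown b x J) (hK : IsGrown b x K)
    {g : V ≃ₗᵢ[ℝ] V} (hg : g ∈ reflectionGroup b)
    (h : orbitPolytope (parabolicSubgroup b (K : Set ι)) x =
      g '' orbitPolytope (parabolicSubgroup b (J : Set ι)) x) : J = K := by
  obtain ⟨p, hp, hpd, hpn, hps⟩ := hb.exists_center hx hJ
  obtain ⟨q, hq, hqd, hqn, hqs⟩ := hb.exists_center hx hK
  have h1 := hqn (g p) (h ▸ ⟨p, hp, rfl⟩)
  obtain ⟨y, hy, rfl⟩ : q ∈ g '' orbitPolytope (parabolicSubgroup b (J : Set ι)) x := h ▸ hq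
  have h2 := hpn y hy
  rw [g.norm_map, g.norm_map] at h1
  have h3 : g p - g y = 0 := by
    rw [← norm_eq_zero, ← sq_eq_zero_iff]
    nlinarith [sq_nonneg ‖y - p‖, sq_nonneg ‖g p - g y‖]
  have h4 : p = y := g.injective (sub_eq_zero.1 h3)
  subst h4
  have h5 := hb.eq_of_isDominant hpd hg hqd
  rw [h5] at hqs
  ext k
  rw [hps, hqs]

/-- In a Platonic orbit polytope there is at most one grown set of each size. -/
theorem eq_of_isPlatonic (hb : IsGeometricBasis M b) [Fintype ι] [DecidableEq ι] {x : V}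
    (hx : IsDominant b x) (hP : IsPlatonic (reflectionGroup b) x) {J K : Finset ι}
    (hJ : IsGrown b x J) (hK : IsGrown b x K) (hcard : J.card = K.card)
    (hlt : J.card < Fintype.card ι) : J = K := by
  rw [← Module.finrank_eq_card_basis b] at hlt
  obtain ⟨F, hF⟩ := hP _ hlt
  have h1 := hb.orbitPolytope_mem_facesOfDim hx hJ
  have h2 := hb.orbitPolytope_mem_facesOfDim hx hK
  rw [← hcard, hF] at h2
  rw [hF] at h1
  obtain ⟨u, hu, h1⟩ := h1
  obtain ⟨v, hv, h2⟩ := h2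
  refine hb.eq_of_image_orbitPolytope_eq hx hJ hK (mul_mem hv (inv_mem hu)) ?_
  rw [h1, h2, ← Set.image_comp]
  congr 1
  funext y
  change v y = v (u.symm (u y))
  rw [u.symm_apply_apply]

end IsGeometricBasis

end Faces

/-! ### The nodes of a Platonic diagram form a path -/

section Path

variable {ι V : Type*} [NormedAddCommGroup V] [InnerProductSpace ℝ V]

namespace IsGeometricBasis

variable {M : CoxeterMatrix ι} {b : Module.Basis ι ℝ V}

/-- Starting from a node whose mirror misses x, nodes are added greedily, each linked to an earlier
one; uniqueness of grown sets of each size below n forces every link to join consecutive nodes. -/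
theorem exists_equiv_of_isPlatonic (hb : IsGeometricBasis M b) [Fintype ι] {n : ℕ}
    (hn : Fintype.card ι = n) {x : V} (hx : IsDominant b x)
    (hP : IsPlatonic (reflectionGroup b) x) {i₀ : ι} (hi₀ : inner ℝ x (b i₀) ≠ (0 : ℝ))
    (hconn : ∀ K : Finset ι, K.Nonempty → K ≠ Finset.univ →
      ∃ k ∈ K, ∃ j ∉ K, inner ℝ (b k) (b j) ≠ (0 : ℝ)) :
    ∃ e : Fin n ≃ ι, ∀ i j : Fin n, i < j →
      (inner ℝ (b (e i)) (b (e j)) ≠ (0 : ℝ) ↔ (i : ℕ) + 1 = j) := by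
  classical
  have hf : ∀ K : Finset ι, ∃ j, K ≠ Finset.univ → j ∉ K ∧ (K = ∅ → inner ℝ x (b j) ≠ (0 : ℝ)) ∧
      (K ≠ ∅ → ∃ k ∈ K, inner ℝ (b k) (b j) ≠ (0 : ℝ)) := by
    intro K
    rcases K.eq_empty_or_nonempty with rfl | hK
    · exact ⟨i₀, fun _ => ⟨by simp, fun _ => hi₀, fun h => absurd rfl h⟩⟩
    · by_cases hu : K = Finset.univ
      · exact ⟨i₀, fun h => absurd hu h⟩
      · obtain ⟨k, hk, j, hj, h⟩ := hconn K hK hu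
        exact ⟨j, fun _ => ⟨hj, fun h => absurd h hK.ne_empty, fun _ => ⟨k, hk, h⟩⟩⟩
  choose f hf using hf
  -- The chain of greedily grown sets; the value of `f` on the full set is junk and never used.
  set J : ℕ → Finset ι := fun k => Nat.rec ∅ (fun _ K => insert (f K) K) k with hJ
  have hJ0 : J 0 = ∅ := rfl
  have hJs : ∀ k, J (k + 1) = insert (f (J k)) (J k) := fun k => rfl
  have hmono : Monotone J := monotone_nat_of_le_succ fun k => by
    rw [hJs]
    exact Finset.subset_insert _ _
  have hcard : ∀ k ≤ n, (J k).card = k := by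
    intro k
    induction k with
    | zero => simp [hJ0]
    | succ k ih =>
      intro hk
      have ih := ih (by omega)
      have hne : J k ≠ Finset.univ := by
        intro h
        rw [h, Finset.card_univ] at ih
        omega
      rw [hJs, Finset.card_insert_of_notMem (hf _ hne).1, ih]
  have hne : ∀ k < n, J k ≠ Finset.univ := by
    intro k hk h
    have := hcard k hk.le
    rw [h, Finset.card_univ] at this
    omega
  have hnot : ∀ k < n, f (J k) ∉ J k := fun k hk => (hf _ (hne k hk)).1
  have hgrown : ∀ k ≤ n, IsGrown b x (J k) := by
    intro k
    induction k with
    | zero => exact fun _ => IsGrown.empty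
    | succ k ih =>
      intro hk
      obtain ⟨h1, h2, h3⟩ := hf _ (hne k hk)
      rw [hJs]
      refine IsGrown.insert _ _ h1 (ih (by omega)) ?_
      by_cases h : J k = ∅
      · exact Or.inl (h2 h)
      · exact Or.inr (h3 h)
  have hmem : ∀ k i, i ∈ J k → ∃ l < k, i = f (J l) := by
    intro k
    induction k with
    | zero => simp [hJ0]
    | succ k ih =>
      intro i hi
      rw [hJs, Finset.mem_insert] at hi
      rcases hi with rfl | hi
      · exact ⟨k, by omega, rfl⟩
      · obtain ⟨l, hl, h⟩ := ih i hi
        exact ⟨l, by omega, h⟩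
  have hmem' : ∀ l k, l < k → f (J l) ∈ J k := by
    intro l k hlk
    have h1 : f (J l) ∈ J (l + 1) := by
      rw [hJs]
      exact Finset.mem_insert_self _ _
    exact hmono (by omega : l + 1 ≤ k) h1
  have hinj : Function.Injective fun k : Fin n => f (J k) := by
    intro k l hkl
    by_contra hne'
    change f (J k) = f (J l) at hkl
    rcases lt_or_gt_of_ne hne' with h | h
    · exact hnot l l.2 (hkl ▸ hmem' k l h)
    · exact hnot k k.2 (hkl ▸ hmem' l k h)
  have hbij := (Fintype.bijective_iff_injective_and_card fun k : Fin n => f (J k)).2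
    ⟨hinj, by simp [hn]⟩
  have hforward : ∀ j k : ℕ, j < k → k < n → inner ℝ (b (f (J j))) (b (f (J k))) ≠ (0 : ℝ) →
      j + 1 = k := by
    intro j k hjk hk h
    by_contra hne'
    -- A link from node j to node k > j + 1 would let node k be added right after j, giving a second
    -- grown set of size j + 2 ≤ k < n.
    have hk' : f (J k) ∉ J (j + 1) := fun h' => hnot k hk (hmono (by omega : j + 1 ≤ k) h')
    have hg : IsGrown b x (insert (f (J k)) (J (j + 1))) :=
      IsGrown.insert _ _ hk' (hgrown (j + 1) (by omega)) (Or.inr ⟨_, hmem' j (j + 1) (by omega), h⟩)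
    have hc : (insert (f (J k)) (J (j + 1))).card = (J (j + 2)).card := by
      rw [Finset.card_insert_of_notMem hk', hcard (j + 1) (by omega), hcard (j + 2) (by omega)]
    have heq := hb.eq_of_isPlatonic hx hP hg (hgrown (j + 2) (by omega)) hc (by
      rw [hc, hcard (j + 2) (by omega)]
      omega)
    have h' : f (J k) ∈ J (j + 2) := heq ▸ Finset.mem_insert_self _ _
    exact hnot k hk (hmono (by omega : j + 2 ≤ k) h')
  refine ⟨Equiv.ofBijective _ hbij, fun i j hij => ⟨hforward i j hij j.2, fun h => ?_⟩⟩
  obtain ⟨-, -, h3⟩ := hf _ (hne j j.2)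
  have hne' : J j ≠ ∅ := by
    intro h'
    have := hcard j j.2.le
    rw [h', Finset.card_empty] at this
    omega
  obtain ⟨k, hk, hkj⟩ := h3 hne'
  obtain ⟨l, hl, rfl⟩ := hmem _ k hk
  have hlj := hforward l j hl j.2 hkj
  have hli : l = i := by omega
  subst hli
  exact hkj

end IsGeometricBasis

end Path

/-! ### A path gives rise to a Platonic solid -/

section PathPlatonic

variable {V : Type*} [NormedAddCommGroup V] [InnerProductSpace ℝ V]

theorem image_mem_facesOfDim {W : Subgroup (V ≃ₗᵢ[ℝ] V)} {x : V} {F : Set V} {d : ℕ}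
    (hF : F ∈ facesOfDim (orbitPolytope W x) d) {g : V ≃ₗᵢ[ℝ] V} (hg : g ∈ W) :
    g '' F ∈ facesOfDim (orbitPolytope W x) d := by
  obtain ⟨hne, hexp, hdim⟩ := hF
  refine ⟨hne.image g, fun _ => ?_, ?_⟩
  · obtain ⟨l, hl⟩ := hexp hne
    refine ⟨l.comp (g.symm.toContinuousLinearEquiv : V →L[ℝ] V), ?_⟩
    have hmem : ∀ {h : V ≃ₗᵢ[ℝ] V}, h ∈ W → ∀ y ∈ orbitPolytope W x, h y ∈ orbitPolytope W x := by
      intro h hh y hy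
      rw [← image_orbitPolytope hh]
      exact ⟨y, hy, rfl⟩
    ext z
    constructor
    · rintro ⟨y, hy, rfl⟩
      rw [hl] at hy
      refine ⟨hmem hg y hy.1, fun u hu => ?_⟩
      change l (g.symm u) ≤ l (g.symm (g y))
      rw [g.symm_apply_apply]
      exact hy.2 _ (hmem (inv_mem hg) u hu)
    · rintro ⟨hz, hmax⟩
      refine ⟨g.symm z, ?_, g.apply_symm_apply z⟩
      rw [hl]
      refine ⟨hmem (inv_mem hg) z hz, fun u hu => ?_⟩
      have h := hmax (g u) (hmem hg u hu)
      change l (g.symm (g u)) ≤ l (g.symm z) at h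
      rwa [g.symm_apply_apply] at h
  · have h := ((g.toLinearEquiv : V →ₗ[ℝ] V).toAffineMap).map_vectorSpan (s := F)
    change Submodule.map (g.toLinearEquiv : V →ₗ[ℝ] V) _ = vectorSpan ℝ (g '' F) at h
    rw [← h, LinearEquiv.finrank_map_eq, hdim]

namespace IsGeometricBasis

variable {n : ℕ} {M : CoxeterMatrix (Fin n)} {b : Module.Basis (Fin n) ℝ V}

/-- The first `d` nodes. -/
def initialNodes (n d : ℕ) : Finset (Fin n) := Finset.univ.filter fun i => (i : ℕ) < d

theorem mem_initialNodes {d : ℕ} {i : Fin n} : i ∈ initialNodes n d ↔ (i : ℕ) < d := by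
  simp [initialNodes]

theorem initialNodes_succ {d : ℕ} (hd : d < n) :
    initialNodes n (d + 1) = insert ⟨d, hd⟩ (initialNodes n d) := by
  ext i
  simp only [mem_initialNodes, Finset.mem_insert, Fin.ext_iff]
  omega

theorem card_initialNodes {d : ℕ} (hd : d ≤ n) : (initialNodes n d).card = d := by
  induction d with
  | zero => simp [initialNodes]
  | succ d ih =>
    rw [initialNodes_succ hd, Finset.card_insert_of_notMem (by simp [mem_initialNodes]),
      ih (by omega)]

theorem isGrown_initialNodes
    (hpath : ∀ i j : Fin n, (i : ℕ) + 1 = j → inner ℝ (b i) (b j) ≠ (0 : ℝ)) {x : V}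
    (hx : ∀ i : Fin n, (i : ℕ) = 0 → inner ℝ x (b i) ≠ (0 : ℝ)) {d : ℕ} (hd : d ≤ n) :
    IsGrown b x (initialNodes n d) := by
  induction d with
  | zero =>
    have : initialNodes n 0 = ∅ := by simp [initialNodes]
    rw [this]
    exact IsGrown.empty
  | succ d ih =>
    rw [initialNodes_succ hd]
    refine IsGrown.insert _ _ (by simp [mem_initialNodes]) (ih (by omega)) ?_
    rcases d with _ | d
    · exact Or.inl (hx _ rfl)
    · exact Or.inr ⟨⟨d, by omega⟩, by simp [mem_initialNodes], hpath _ _ rfl⟩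

/-- If `d` is the first node outside `J`, only the nodes before `d` matter for the orbit of the
first fundamental weight. -/
theorem orbitPolytope_eq_initialNodes (hb : IsGeometricBasis M b)
    (hfar : ∀ i j : Fin n, (i : ℕ) + 1 < j → inner ℝ (b i) (b j) = (0 : ℝ)) {x : V}
    (hx : ∀ i : Fin n, (i : ℕ) ≠ 0 → inner ℝ x (b i) = (0 : ℝ)) {J : Set (Fin n)} {d : ℕ}
    (hd : ∀ i : Fin n, (i : ℕ) < d → i ∈ J) (hd' : ∀ i : Fin n, (i : ℕ) = d → i ∉ J) :
    orbitPolytope (parabolicSubgroup b J) x =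
      orbitPolytope (parabolicSubgroup b (initialNodes n d : Set (Fin n))) x := by
  unfold orbitPolytope
  congr 1
  ext y
  constructor
  · rintro ⟨w, hw, rfl⟩
    refine parabolicSubgroup_induction
      (p := fun v => ∃ w ∈ parabolicSubgroup b (initialNodes n d : Set (Fin n)), v = w x)
      ?_ hw ⟨1, one_mem _, rfl⟩
    rintro i hi _ ⟨u, hu, rfl⟩
    by_cases hid : (i : ℕ) < d
    · exact ⟨rootReflection (b i) * u, mul_mem (rootReflection_mem_parabolicSubgroup b
        (by simpa [mem_initialNodes] using hid)) hu, rfl⟩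
    · have hne : (i : ℕ) ≠ d := fun h => hd' i h hi
      refine ⟨u, hu, ?_⟩
      -- The node i lies beyond the gap at d, so `b i` is orthogonal to x and to all roots before d,
      -- hence to u x: the reflection does nothing.
      have horth : inner ℝ (x - u x) (b i) = (0 : ℝ) := by
        refine Submodule.span_induction (p := fun v _ => inner ℝ v (b i) = (0 : ℝ)) ?_ ?_ ?_ ?_
          (hb.sub_mem_span hu x)
        · rintro _ ⟨j, hj, rfl⟩
          have hj' : (j : ℕ) < d := by simpa [mem_initialNodes] using hj
          exact hfar j i (by omega)
        · exact inner_zero_left _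
        · intro u v _ _ hu hv
          rw [inner_add_left, hu, hv, add_zero]
        · intro r v _ hv
          rw [real_inner_smul_left, hv, mul_zero]
      rw [inner_sub_left, hx i (by omega)] at horth
      have h0 : inner ℝ (u x) (b i) = (0 : ℝ) := by linarith
      rw [hb.refl_apply, h0]
      simp
  · rintro ⟨w, hw, rfl⟩
    refine ⟨w, Subgroup.closure_mono (Set.image_mono fun i hi => hd i ?_) hw, rfl⟩
    simpa [mem_initialNodes] using hi

/-- Here x is the first fundamental weight. Moving the normal of a face into the dominant cone turns
the face into conv(W_J x), which only sees the initial segment of J; the dimension tells how long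
that segment is. -/
theorem isPlatonic_of_path (hb : IsGeometricBasis M b)
    (hpath : ∀ i j : Fin n, (i : ℕ) + 1 = j → inner ℝ (b i) (b j) ≠ (0 : ℝ))
    (hfar : ∀ i j : Fin n, (i : ℕ) + 1 < j → inner ℝ (b i) (b j) = (0 : ℝ)) {x : V}
    (hx : ∀ i : Fin n, inner ℝ x (b i) = if (i : ℕ) = 0 then (1 : ℝ) else 0) :
    IsPlatonic (reflectionGroup b) x := by
  have : FiniteDimensional ℝ V := b.finiteDimensional_of_finite
  have : CompleteSpace V := FiniteDimensional.complete ℝ V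
  have hxd : IsDominant b x := fun i => by
    rw [hx]
    split_ifs <;> norm_num
  have hx0 : ∀ i : Fin n, (i : ℕ) = 0 → inner ℝ x (b i) ≠ (0 : ℝ) := fun i h => by
    rw [hx, if_pos h]
    norm_num
  have hx1 : ∀ i : Fin n, (i : ℕ) ≠ 0 → inner ℝ x (b i) = (0 : ℝ) := fun i h => by
    rw [hx, if_neg h]
  have hgrown : ∀ d ≤ n, IsGrown b x (initialNodes n d) :=
    fun d hd => isGrown_initialNodes hpath hx0 hd
  intro d hd
  rw [Module.finrank_eq_card_basis b, Fintype.card_fin] at hd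
  refine ⟨orbitPolytope (parabolicSubgroup b (initialNodes n d : Set (Fin n))) x, ?_⟩
  ext F
  constructor
  · intro hF
    obtain ⟨l, hl⟩ := hF.2.1 hF.1
    set c := (InnerProductSpace.toDual ℝ V).symm l with hc
    have hlc : ∀ y, l y = inner ℝ c y := fun y => by
      rw [hc, InnerProductSpace.toDual_symm_apply]
    obtain ⟨g, hg, hgc⟩ := hb.exists_isDominant c
    set J : Set (Fin n) := {i | inner ℝ (g c) (b i) = (0 : ℝ)} with hJ
    have hface := hb.face_eq hxd hgc (J := J) fun i => Iff.rfl
    have hgF : g '' F = orbitPolytope (parabolicSubgroup b J) x := by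
      rw [← hface, hl]
      have hP := image_orbitPolytope hg x
      ext z
      constructor
      · rintro ⟨y, ⟨hy, hmax⟩, rfl⟩
        refine ⟨hP ▸ ⟨y, hy, rfl⟩, fun u hu => ?_⟩
        rw [← hP] at hu
        obtain ⟨u, hu, rfl⟩ := hu
        rw [g.inner_map_map, g.inner_map_map, ← hlc, ← hlc]
        exact hmax u hu
      · rintro ⟨hz, hmax⟩
        rw [← hP] at hz
        obtain ⟨y, hy, rfl⟩ := hz
        refine ⟨y, ⟨hy, fun u hu => ?_⟩, rfl⟩
        have h := hmax (g u) (hP ▸ ⟨u, hu, rfl⟩)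
        rwa [g.inner_map_map, g.inner_map_map, ← hlc, ← hlc] at h
    classical
    -- The index n qualifies vacuously, which covers the case where J contains all nodes.
    have hex : ∃ m : ℕ, ∀ i : Fin n, (i : ℕ) = m → i ∉ J := ⟨n, fun i hi => absurd i.2 (by omega)⟩
    set m := Nat.find hex with hm
    have hmn : m ≤ n := Nat.find_min' hex fun i hi => absurd i.2 (by omega)
    have hm1 : ∀ i : Fin n, (i : ℕ) < m → i ∈ J := by
      intro i hi
      have h := Nat.find_min hex hi
      push Not at h
      obtain ⟨j, hj, hjJ⟩ := h
      rwa [← Fin.ext hj]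
    have heq := hb.orbitPolytope_eq_initialNodes hfar hx1 hm1 (Nat.find_spec hex)
    have hdim := (hb.orbitPolytope_mem_facesOfDim hxd (hgrown m hmn)).2.2
    have hdim' := (image_mem_facesOfDim hF hg).2.2
    rw [hgF, heq, hdim, card_initialNodes hmn] at hdim'
    refine ⟨g⁻¹, inv_mem hg, ?_⟩
    rw [← hdim', ← heq, ← hgF, ← Set.image_comp]
    have : (g⁻¹ : V ≃ₗᵢ[ℝ] V) ∘ g = id := funext fun y => g.symm_apply_apply y
    rw [this, Set.image_id]
  · rintro ⟨w, hw, rfl⟩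
    have h := hb.orbitPolytope_mem_facesOfDim hxd (hgrown d hd.le)
    rw [card_initialNodes hd.le] at h
    exact image_mem_facesOfDim h hw

end IsGeometricBasis

end PathPlatonic

/-! ### The labels of a path with positive definite Gram matrix -/

section UnitPath

open Real

variable {V : Type*} [NormedAddCommGroup V] [InnerProductSpace ℝ V]

/-! ### Lower bounds for the cosines of the labels -/

theorem cos_pi_div_le_cos_pi_div {k m : ℕ} (hk : 1 ≤ k) (hkm : k ≤ m) :
    cos (π / k) ≤ cos (π / m) := by
  have h1 : (1 : ℝ) ≤ k := by exact_mod_cast hk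
  have h2 : (k : ℝ) ≤ m := by exact_mod_cast hkm
  apply cos_le_cos_of_nonneg_of_le_pi
  · positivity
  · exact div_le_self pi_pos.le h1
  · exact div_le_div_of_nonneg_left pi_pos.le (by linarith) h2

theorem half_le_cos {m : ℕ} (h : 3 ≤ m) : 1 / 2 ≤ cos (π / m) := by
  have := cos_pi_div_le_cos_pi_div (by norm_num) h
  simpa using this

theorem sqrt_two_div_two_le_cos {m : ℕ} (h : 4 ≤ m) : √2 / 2 ≤ cos (π / m) := by
  have := cos_pi_div_le_cos_pi_div (by norm_num) h
  simpa using this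

/-- A rational bound for cos(π/5) = (1 + √5)/4, from √5 > 2.2. -/
theorem cos_pi_div_five_bound {m : ℕ} (h : 5 ≤ m) : (4 : ℝ) / 5 < cos (π / m) := by
  have h1 := cos_pi_div_le_cos_pi_div (by norm_num) h
  push_cast at h1
  rw [cos_pi_div_five] at h1
  have h2 : (2.2 : ℝ) < √5 := lt_sqrt_of_sq_lt (by norm_num)
  linarith

theorem sqrt_three_div_two_le_cos {m : ℕ} (h : 6 ≤ m) : √3 / 2 ≤ cos (π / m) := by
  have := cos_pi_div_le_cos_pi_div (by norm_num) h
  simpa using this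

/-- Linearly independent unit vectors `u 0, …, u (n - 1)` whose angles are prescribed by a path with
labels `m`. -/
structure IsUnitPath (n : ℕ) (m : ℕ → ℕ) (u : ℕ → V) : Prop where
  three_le : ∀ k, k + 1 < n → 3 ≤ m k
  inner_self : ∀ k < n, inner ℝ (u k) (u k) = (1 : ℝ)
  inner_succ : ∀ k, k + 1 < n → inner ℝ (u k) (u (k + 1)) = -cos (π / m k)
  inner_far : ∀ j k, j + 1 < k → k < n → inner ℝ (u j) (u k) = (0 : ℝ)
  -- Linear independence, stated through coordinate functionals.
  exists_coord : ∀ i < n, ∃ φ : V →ₗ[ℝ] ℝ, φ (u i) = 1 ∧ ∀ k < n, k ≠ i → φ (u k) = 0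

namespace IsUnitPath

variable {n : ℕ} {m : ℕ → ℕ} {u : ℕ → V}

theorem reverse (hu : IsUnitPath n m u) :
    IsUnitPath n (fun k => m (n - 2 - k)) (fun k => u (n - 1 - k)) where
  three_le k hk := hu.three_le _ (by omega)
  inner_self k hk := hu.inner_self _ (by omega)
  inner_succ k hk := by
    have h := hu.inner_succ (n - 2 - k) (by omega)
    rw [real_inner_comm] at h
    have e1 : n - 2 - k + 1 = n - 1 - k := by omega
    have e2 : n - 1 - (k + 1) = n - 2 - k := by omega
    rw [e2, ← h, e1]
  inner_far j k hjk hk := by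
    rw [real_inner_comm]
    exact hu.inner_far _ _ (by omega) (by omega)
  exists_coord i hi := by
    obtain ⟨φ, h1, h2⟩ := hu.exists_coord (n - 1 - i) (by omega)
    exact ⟨φ, h1, fun k hk hki => h2 _ (by omega) (by omega)⟩

theorem inner_sum_succ (hu : IsUnitPath n m u) (y : ℕ → ℝ) (i l : ℕ) (h : i + l + 1 < n) :
    inner ℝ (∑ t ∈ Finset.range (l + 1), y t • u (i + t)) (u (i + l + 1)) =
      -(y l * cos (π / m (i + l))) := by
  rw [Finset.sum_range_succ, inner_add_left, sum_inner, real_inner_smul_left,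
    hu.inner_succ _ h, Finset.sum_eq_zero]
  · ring
  · intro t ht
    rw [Finset.mem_range] at ht
    rw [real_inner_smul_left, hu.inner_far _ _ (by omega) h, mul_zero]

/-- The expansion of ‖Σ y_t u_{i+t}‖² > 0. Each exclusion below chooses a weight y violating it. -/
theorem quadratic_pos (hu : IsUnitPath n m u) (y : ℕ → ℝ) (hy : y 0 ≠ 0) (i l : ℕ)
    (h : i + l < n) :
    2 * ∑ t ∈ Finset.range l, y t * y (t + 1) * cos (π / m (i + t)) <
      ∑ t ∈ Finset.range (l + 1), y t ^ 2 := by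
  set S : ℕ → V := fun l => ∑ t ∈ Finset.range (l + 1), y t • u (i + t) with hS
  have hsq : ∀ l, i + l < n → inner ℝ (S l) (S l) = ∑ t ∈ Finset.range (l + 1), y t ^ 2 -
      2 * ∑ t ∈ Finset.range l, y t * y (t + 1) * cos (π / m (i + t)) := by
    intro l
    induction l with
    | zero =>
      intro h
      have h1 := hu.inner_self i h
      rw [hS]
      simp only [zero_add, Finset.sum_range_one, Finset.sum_range_zero, add_zero,
        real_inner_smul_left, real_inner_smul_right, h1]
      ring
    | succ l ih =>
      intro h
      have e : S (l + 1) = S l + y (l + 1) • u (i + l + 1) := by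
        rw [hS]
        simp only
        rw [Finset.sum_range_succ _ (l + 1)]
        rfl
      have h1 := hu.inner_sum_succ y i l h
      rw [e, inner_add_left, inner_add_right, inner_add_right, ih (by omega),
        real_inner_smul_left, real_inner_smul_left, real_inner_smul_right, real_inner_smul_right,
        real_inner_comm (S l) (u (i + l + 1)), h1, hu.inner_self (i + l + 1) h,
        Finset.sum_range_succ _ (l + 1),
        Finset.sum_range_succ (fun t => y t * y (t + 1) * cos (π / m (i + t))) l]
      ring
  have hne : S l ≠ 0 := by
    intro h0
    obtain ⟨φ, h1, h2⟩ := hu.exists_coord i (by omega)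
    have h3 : φ (S l) = y 0 := by
      rw [hS]
      simp only
      rw [Finset.sum_range_succ', map_add, map_sum, Finset.sum_eq_zero]
      · simp [h1]
      · intro t ht
        rw [Finset.mem_range] at ht
        rw [map_smul, h2 _ (by omega) (by omega), smul_zero]
    rw [h0, map_zero] at h3
    exact hy h3.symm
  have h4 := real_inner_self_pos.2 hne
  rw [hsq l h] at h4
  linarith

/-- The weights 1, √2, ..., √2, 1 form the null vector of the affine diagram of type C: each of the
l + 2 links contributes at least 1, while the squares add up to 2(l + 2). -/
theorem eq_of_four_le (hu : IsUnitPath n m u) {i j : ℕ} (hij : i < j) (hj : j + 1 < n)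
    (hmi : 4 ≤ m i) (hmj : 4 ≤ m j) : False := by
  obtain ⟨l, rfl⟩ : ∃ l, j = i + l + 1 := ⟨j - i - 1, by omega⟩
  set y : ℕ → ℝ := fun t => if t = 0 ∨ t = l + 2 then 1 else √2 with hy
  have hs : √2 * √2 = (2 : ℝ) := mul_self_sqrt (by norm_num)
  have h := hu.quadratic_pos y (by simp [hy]) i (l + 2) (by omega)
  have h1 : ∑ t ∈ Finset.range (l + 2 + 1), y t ^ 2 ≤ 2 * (l + 2) := by
    rw [Finset.sum_range_succ, Finset.sum_range_succ']
    have : ∑ t ∈ Finset.range (l + 1), y (t + 1) ^ 2 = ∑ t ∈ Finset.range (l + 1), (2 : ℝ) := by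
      refine Finset.sum_congr rfl fun t ht => ?_
      rw [Finset.mem_range] at ht
      have hne : ¬ (t + 1 = 0 ∨ t + 1 = l + 2) := by omega
      simp only [hy, if_neg hne]
      rw [sq, hs]
    rw [this, Finset.sum_const, Finset.card_range, nsmul_eq_mul]
    simp only [hy, true_or, or_true, if_true]
    push_cast
    linarith
  have h2 : ∑ t ∈ Finset.range (l + 2), (1 : ℝ) ≤
      ∑ t ∈ Finset.range (l + 2), y t * y (t + 1) * cos (π / m (i + t)) := by
    refine Finset.sum_le_sum fun t ht => ?_
    rw [Finset.mem_range] at ht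
    rcases Nat.eq_zero_or_pos t with rfl | ht0
    · have e : ¬ (0 + 1 = 0 ∨ 0 + 1 = l + 2) := by omega
      simp only [hy, true_or, if_true, if_neg e, add_zero]
      have := sqrt_two_div_two_le_cos hmi
      nlinarith [sqrt_nonneg 2]
    · have e : ¬ (t = 0 ∨ t = l + 2) := by omega
      rcases eq_or_ne t (l + 1) with rfl | htl
      · simp only [hy, or_true, if_true, if_neg e]
        have := sqrt_two_div_two_le_cos hmj
        rw [add_assoc] at this
        nlinarith [sqrt_nonneg 2]
      · have e' : ¬ (t + 1 = 0 ∨ t + 1 = l + 2) := by omega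
        simp only [hy, if_neg e, if_neg e', hs]
        have := half_le_cos (hu.three_le (i + t) (by omega))
        linarith
  rw [Finset.sum_const, Finset.card_range, nsmul_eq_mul] at h2
  push_cast at h2
  linarith

/-- The weights √3, 2, 1 form the null vector of the affine diagram of type G₂; both sides equal 8
for labels 6, 3. -/
theorem lt_six_of_succ (hu : IsUnitPath n m u) {k : ℕ} (hk : k + 2 < n) : m k < 6 := by
  by_contra hcon
  push Not at hcon
  have h := hu.quadratic_pos (fun t => if t = 0 then √3 else if t = 1 then 2 else 1)
    (by simp) k 2 hk
  have h1 := sqrt_three_div_two_le_cos hcon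
  have h2 := half_le_cos (hu.three_le (k + 1) hk)
  have hs : √3 * √3 = (3 : ℝ) := mul_self_sqrt (by norm_num)
  simp [Finset.sum_range_succ] at h
  nlinarith [sqrt_nonneg 3]

theorem lt_six (hu : IsUnitPath n m u) (hn : 3 ≤ n) {k : ℕ} (hk : k + 1 < n) : m k < 6 := by
  by_cases h : k + 2 < n
  · exact hu.lt_six_of_succ h
  · have h' := hu.reverse.lt_six_of_succ (k := n - 2 - k) (by omega)
    have e : n - 2 - (n - 2 - k) = k := by omega
    rwa [e] at h'

/-- The weights √2, 2√2, 3, 2, 1 form the null vector of the affine diagram of type F₄; both sides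
equal 24 for labels 3, 4, 3, 3. -/
theorem le_of_four_le (hu : IsUnitPath n m u) {k : ℕ} (hk1 : 1 ≤ k) (hk : k + 2 < n)
    (hm : 4 ≤ m k) : n ≤ k + 3 := by
  by_contra hcon
  obtain ⟨i, rfl⟩ : ∃ i, k = i + 1 := ⟨k - 1, by omega⟩
  have h := hu.quadratic_pos (fun t => if t = 0 then √2 else if t = 1 then 2 * √2 else
    if t = 2 then 3 else if t = 3 then 2 else 1) (by simp) i 4 (by omega)
  have h0 := half_le_cos (hu.three_le i (by omega))
  have h1 := sqrt_two_div_two_le_cos hm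
  have h2 := half_le_cos (hu.three_le (i + 2) (by omega))
  have h3 := half_le_cos (hu.three_le (i + 3) (by omega))
  have hs : √2 * √2 = (2 : ℝ) := mul_self_sqrt (by norm_num)
  simp [Finset.sum_range_succ, mul_pow] at h
  have e : √2 * (2 * √2) = (4 : ℝ) := by linarith
  rw [e] at h
  nlinarith [mul_le_mul_of_nonneg_left h1 (sqrt_nonneg 2)]

/-- With weights 1, 2, 2, 1 the squares add up to 10, and the links give more than 2(1 + 4 · 0.8 +
1) = 10.4. -/
theorem not_five_le_interior (hu : IsUnitPath n m u) {k : ℕ} (hk1 : 1 ≤ k) (hk : k + 2 < n)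
    (hm : 5 ≤ m k) : False := by
  obtain ⟨i, rfl⟩ : ∃ i, k = i + 1 := ⟨k - 1, by omega⟩
  have h := hu.quadratic_pos (fun t => if t = 0 then 1 else if t = 1 then 2 else
    if t = 2 then 2 else 1) (by simp) i 3 (by omega)
  have h0 := half_le_cos (hu.three_le i (by omega))
  have h1 := cos_pi_div_five_bound hm
  have h2 := half_le_cos (hu.three_le (i + 2) (by omega))
  simp [Finset.sum_range_succ] at h
  linarith

/-- The weights decrease linearly along the simple links, and 3.2 = 4 · 0.8 is the best first weight
for the cosine bound 4/5: squares 40.24 against links above 40.48. -/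
theorem le_four_of_five_le (hu : IsUnitPath n m u) (hm : 5 ≤ m 0) : n ≤ 4 := by
  by_contra hcon
  have h := hu.quadratic_pos (fun t => if t = 0 then 3.2 else if t = 1 then 4 else
    if t = 2 then 3 else if t = 3 then 2 else 1) (by norm_num) 0 4 (by omega)
  have h0 := half_le_cos (hu.three_le 1 (by omega))
  have h1 := cos_pi_div_five_bound hm
  have h2 := half_le_cos (hu.three_le 2 (by omega))
  have h3 := half_le_cos (hu.three_le 3 (by omega))
  simp [Finset.sum_range_succ] at h
  linarith

/-- The possible labels of a path with positive definite Gram matrix. -/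
theorem labels (hu : IsUnitPath n m u) (hn : 3 ≤ n) :
    (∀ k, k + 1 < n → m k = 3) ∨ ∃ k, k + 1 < n ∧ (∀ j, j ≠ k → j + 1 < n → m j = 3) ∧
      ((m k = 4 ∧ (k = 0 ∨ k + 2 = n ∨ n = 4 ∧ k = 1)) ∨
        (m k = 5 ∧ n ≤ 4 ∧ (k = 0 ∨ k + 2 = n))) := by
  by_cases h : ∀ k, k + 1 < n → m k = 3
  · exact Or.inl h
  push Not at h
  obtain ⟨k, hk, hm⟩ := h
  have h3 := hu.three_le k hk
  have h6 := hu.lt_six hn hk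
  refine Or.inr ⟨k, hk, fun j hjk hj => ?_, ?_⟩
  · by_contra hmj
    have := hu.three_le j hj
    rcases lt_or_gt_of_ne hjk with h | h
    · exact hu.eq_of_four_le h hk (by omega) (by omega)
    · exact hu.eq_of_four_le h hj (by omega) (by omega)
  have e : n - 2 - (n - 2 - k) = k := by omega
  by_cases h4 : m k = 4
  · refine Or.inl ⟨h4, ?_⟩
    by_contra hcon
    have h1 := hu.le_of_four_le (k := k) (by omega) (by omega) h4.ge
    have h2 := hu.reverse.le_of_four_le (k := n - 2 - k) (by omega) (by omega)
      (by simp only [e]; exact h4.ge)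
    omega
  · have h5 : m k = 5 := by omega
    have hend : k = 0 ∨ k + 2 = n := by
      by_contra hcon
      exact hu.not_five_le_interior (k := k) (by omega) (by omega) h5.ge
    refine Or.inr ⟨h5, ?_, hend⟩
    rcases hend with rfl | hend
    · exact hu.le_four_of_five_le h5.ge
    · refine hu.reverse.le_four_of_five_le ?_
      have e' : n - 2 - 0 = k := by omega
      simp only [e']
      exact h5.ge

end IsUnitPath

end UnitPath

/-! ### Existence of simple roots for paths -/

section Existence

open Real

/-- Cholesky factorisation of the tridiagonal Gram matrix with pivots d: the vectors are bidiagonal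
in the standard basis. -/
theorem exists_unit_path (n : ℕ) (c d : ℕ → ℝ) (hd0 : d 0 = 1) (hd : ∀ k < n, 0 < d k)
    (hds : ∀ k, k + 1 < n → d (k + 1) = 1 - c k ^ 2 / d k) :
    ∃ u : Fin n → EuclideanSpace ℝ (Fin n), LinearIndependent ℝ u ∧
      (∀ i, inner ℝ (u i) (u i) = (1 : ℝ)) ∧
      (∀ i j : Fin n, (i : ℕ) + 1 = j → inner ℝ (u i) (u j) = -c i) ∧
      ∀ i j : Fin n, (i : ℕ) + 1 < j → inner ℝ (u i) (u j) = (0 : ℝ) := by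
  set e : ℕ → EuclideanSpace ℝ (Fin n) := fun k =>
    if h : k < n then EuclideanSpace.single ⟨k, h⟩ 1 else 0 with he
  have hee : ∀ j k, j < n → k < n → inner ℝ (e j) (e k) = if j = k then (1 : ℝ) else 0 := by
    intro j k hj hk
    simp [he, hj, hk, EuclideanSpace.inner_single_left, Fin.ext_iff]
  -- With `f 0 = 0` the truncated index 0 - 1 = 0 in `v` is harmless.
  set f : ℕ → ℝ := fun k => if k = 0 then 0 else c (k - 1) / √(d (k - 1)) with hf
  set v : ℕ → EuclideanSpace ℝ (Fin n) := fun k => √(d k) • e k - f k • e (k - 1) with hv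
  have hinner : ∀ j k, j < n → k < n → inner ℝ (v j) (v k) =
      √(d j) * √(d k) * (if j = k then 1 else 0) - √(d j) * f k * (if j = k - 1 then 1 else 0) -
      f j * √(d k) * (if j - 1 = k then 1 else 0) +
      f j * f k * (if j - 1 = k - 1 then (1 : ℝ) else 0) := by
    intro j k hj hk
    simp only [hv, inner_sub_left, inner_sub_right, real_inner_smul_left, real_inner_smul_right]
    rw [hee _ _ hj hk, hee _ _ hj (by omega), hee _ _ (by omega) hk, hee _ _ (by omega) (by omega)]
    ring
  have hsq : ∀ k < n, √(d k) * √(d k) = d k := fun k hk => mul_self_sqrt (hd k hk).le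
  have hpos : ∀ k < n, 0 < √(d k) := fun k hk => sqrt_pos.2 (hd k hk)
  refine ⟨fun i => v i, ?_, fun i => ?_, fun i j hij => ?_, fun i j hij => ?_⟩
  · apply linearIndependent_of_top_le_span_of_card_eq_finrank
    -- Forward substitution: the diagonal coefficients √(d k) are nonzero.
    · have hmem : ∀ k (hk : k < n), e k ∈ Submodule.span ℝ (Set.range fun i : Fin n => v i) := by
        intro k
        induction k with
        | zero =>
          intro hk
          have h : v 0 ∈ Submodule.span ℝ (Set.range fun i : Fin n => v i) :=
            Submodule.subset_span ⟨⟨0, hk⟩, rfl⟩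
          simpa [hv, hf, hd0] using h
        | succ k ih =>
          intro hk
          have h : v (k + 1) ∈ Submodule.span ℝ (Set.range fun i : Fin n => v i) :=
            Submodule.subset_span ⟨⟨k + 1, hk⟩, rfl⟩
          have h2 : √(d (k + 1)) • e (k + 1) = v (k + 1) + f (k + 1) • e k := by
            simp [hv]
          have h3 := add_mem h (Submodule.smul_mem _ (f (k + 1)) (ih (by omega)))
          rw [← h2] at h3
          exact (Submodule.smul_mem_iff _ (hpos _ hk).ne').1 h3
      rw [← (EuclideanSpace.basisFun (Fin n) ℝ).toBasis.span_eq, Submodule.span_le]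
      rintro _ ⟨i, rfl⟩
      have h := hmem i i.2
      simpa [he] using h
    · simp
  · rw [hinner i i i.2 i.2]
    rcases i with ⟨k, hk⟩
    rcases k with _ | k
    · simp [hf, hd0]
    · have h1 := hsq (k + 1) hk
      have h2 := hsq k (by omega)
      have h4 := hds k hk
      have hf2 : f (k + 1) * f (k + 1) = c k ^ 2 / d k := by
        simp only [hf]
        rw [if_neg (by omega), Nat.add_sub_cancel, div_mul_div_comm, h2, ← sq]
      simp
      rw [h1, hf2, h4]
      ring
  · rw [hinner i j i.2 j.2]
    rcases i with ⟨k, hk⟩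
    rcases j with ⟨l, hl⟩
    simp only at hij
    subst hij
    have h3 := (hpos k hk).ne'
    rcases k with _ | k
    · simp [hf, hd0]
    · have hne : ¬ k = k + 1 + 1 := by omega
      simp [hf, hne]
      field_simp
  · rw [hinner i j i.2 j.2, if_neg (by omega), if_neg (by omega), if_neg (by omega)]
    by_cases h : (i : ℕ) = 0
    · simp [hf, h]
    · rw [if_neg (by omega)]
      simp

namespace CoxeterDynkinDiagram

/-- Root lengths affect neither angles nor mirrors, so the geometry of W may be studied with unit
vectors. -/
theorem IsSimpleRoots.exists_isGeometricBasis {ι V : Type*} [Fintype ι] [Nonempty ι]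
    [NormedAddCommGroup V] [InnerProductSpace ℝ V] {D : CoxeterDynkinDiagram ι} {α : ι → V}
    (hα : D.IsSimpleRoots α) (hcard : Fintype.card ι = Module.finrank ℝ V) :
    ∃ b : Module.Basis ι ℝ V, IsGeometricBasis D.M b ∧ reflectionGroup b = reflectionGroup α := by
  have hne : ∀ i, ‖α i‖ ≠ 0 := fun i => norm_ne_zero_iff.2 (hα.linearIndependent.ne_zero i)
  have hli : LinearIndependent ℝ fun i => ‖α i‖⁻¹ • α i :=
    hα.linearIndependent.units_smul fun i => (Units.mk0 _ (hne i))⁻¹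
  have hb : ∀ i, basisOfLinearIndependentOfCardEqFinrank hli hcard i = ‖α i‖⁻¹ • α i := fun i => by
    simp
  refine ⟨basisOfLinearIndependentOfCardEqFinrank hli hcard, ⟨fun i j => ?_⟩, ?_⟩
  · rw [hb, hb, real_inner_smul_left, real_inner_smul_right, hα.inner_eq]
    have h1 := hne i
    have h2 := hne j
    field_simp
  · unfold reflectionGroup
    congr 2
    funext i
    exact (congrArg rootReflection (hb i)).trans (rootReflection_smul (inv_ne_zero (hne i)) _)

theorem IsSimpleRoots.givesPlatonicSolid {n : ℕ} (hn : 0 < n) {D : CoxeterDynkinDiagram (Fin n)}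
    {α : Fin n → EuclideanSpace ℝ (Fin n)} (hα : D.IsSimpleRoots α)
    (hfar : ∀ i j : Fin n, (i : ℕ) + 1 < j → D.M i j = 2)
    (hadj : ∀ i j : Fin n, (i : ℕ) + 1 = j → D.M i j ≠ 2) : D.GivesPlatonicSolid := by
  have : Nonempty (Fin n) := ⟨⟨0, hn⟩⟩
  obtain ⟨b, hb, hW⟩ := hα.exists_isGeometricBasis (by simp)
  obtain ⟨x, hx⟩ := exists_inner_basis_eq b fun i => if (i : ℕ) = 0 then 1 else 0
  refine ⟨α, hα, hW ▸ hb.finite_reflectionGroup, x, hW ▸ hb.isPlatonic_of_path ?_ ?_ hx⟩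
  · intro i j hij
    exact (hb.inner_neg (by rintro rfl; omega) (hadj i j hij)).ne
  · intro i j hij
    exact hb.inner_eq_zero (hfar i j hij)

/-- A path whose Gram matrix has positive pivots `d` and which has consistent lengths `r` gives rise
to a Platonic solid. -/
theorem givesPlatonicSolid_of_pivots {n : ℕ} (hn : 0 < n) {D : CoxeterDynkinDiagram (Fin n)}
    (hfar : ∀ i j : Fin n, (i : ℕ) + 1 < j → D.M i j = 2)
    (hadj : ∀ i j : Fin n, (i : ℕ) + 1 = j → D.M i j ≠ 2)
    (d : ℕ → ℝ) (hd0 : d 0 = 1) (hd : ∀ k < n, 0 < d k)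
    (hds : ∀ i j : Fin n, (i : ℕ) + 1 = j → d j = 1 - cos (π / (D.M i j : ℝ)) ^ 2 / d i)
    (r : Fin n → ℝ) (hr : ∀ i, 0 < r i)
    (hr1 : ∀ i j, D.graph.Adj i j → ¬ D.longer i j → ¬ D.longer j i → r i = r j)
    (hr2 : ∀ i j, D.longer i j → D.M i j = 4 → r i = √2 * r j)
    (hr3 : ∀ i j, D.longer i j → D.M i j = 6 → r i = √3 * r j) : D.GivesPlatonicSolid := by
  obtain ⟨u, hli, h1, h2, h3⟩ := exists_unit_path n
    (fun k => if h : k + 1 < n then cos (π / (D.M ⟨k, by omega⟩ ⟨k + 1, h⟩ : ℝ)) else 0) d hd0 hd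
    (fun k hk => by
      rw [dif_pos hk]
      exact hds ⟨k, by omega⟩ ⟨k + 1, hk⟩ rfl)
  have hnorm : ∀ i, ‖r i • u i‖ = r i := by
    intro i
    have : ‖u i‖ = 1 := by
      have h := h1 i
      rw [real_inner_self_eq_norm_sq] at h
      nlinarith [norm_nonneg (u i)]
    rw [norm_smul, this, mul_one, Real.norm_of_nonneg (hr i).le]
  have hlt : ∀ i j : Fin n, i < j → inner ℝ (u i) (u j) = -cos (π / (D.M i j : ℝ)) := by
    intro i j hij
    by_cases h : (i : ℕ) + 1 = j
    · obtain ⟨j, hj⟩ := j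
      change (i : ℕ) + 1 = j at h
      subst h
      rw [h2 i _ rfl, dif_pos hj]
    · have hlt' : (i : ℕ) + 1 < j := by
        have : (i : ℕ) < j := hij
        omega
      rw [h3 i j hlt', hfar i j hlt']
      simp
  refine IsSimpleRoots.givesPlatonicSolid hn (α := fun i => r i • u i) ⟨?_, fun i j => ?_, ?_, ?_, ?_⟩
    hfar hadj
  · exact hli.units_smul fun i => Units.mk0 _ (hr i).ne'
  · rw [hnorm, hnorm, real_inner_smul_left, real_inner_smul_right]
    have key : inner ℝ (u i) (u j) = -cos (π / (D.M i j : ℝ)) := by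
      rcases lt_trichotomy i j with h | rfl | h
      · exact hlt i j h
      · rw [h1, D.M.diagonal]
        simp
      · rw [real_inner_comm, hlt j i h, D.M.symmetric]
    rw [key]
    ring
  · simpa only [hnorm] using hr1
  · simpa only [hnorm] using hr2
  · simpa only [hnorm] using hr3

/-! ### Pivots and root lengths of the listed diagrams -/

theorem A_pivot (k : ℕ) :
    ((k + 1 : ℕ) + 2 : ℝ) / (2 * ((k + 1 : ℕ) + 1)) =
      1 - (1 / 2) ^ 2 / ((k + 2 : ℝ) / (2 * (k + 1))) := by
  push_cast
  field_simp
  ring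

theorem givesPlatonicSolid_A {n : ℕ} (hn : 3 ≤ n) : (A n).GivesPlatonicSolid := by
  have hM : ∀ i j : Fin n, (i : ℕ) + 1 = j → (A n).M i j = 3 := by
    intro i j hij
    simp only [A, CoxeterMatrix.A, Matrix.of_apply, Fin.ext_iff]
    split_ifs <;> omega
  refine givesPlatonicSolid_of_pivots (by omega) (fun i j hij => ?_) (fun i j hij => ?_)
    -- The values 1, 3/4, 2/3, ... solve d_{k+1} = 1 - 1/(4 d_k).
    (fun k => (k + 2) / (2 * (k + 1))) (by norm_num) (fun k _ => by positivity) (fun i j hij => ?_)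
    (fun _ => 1) (fun _ => one_pos) (fun _ _ _ _ _ => rfl) (fun _ _ h => h.elim)
    (fun _ _ h => h.elim)
  · simp only [A, CoxeterMatrix.A, Matrix.of_apply, Fin.ext_iff]
    split_ifs <;> omega
  · rw [hM i j hij]
    norm_num
  · rw [hM i j hij, ← hij]
    have := A_pivot i
    simpa using this

theorem B_M_of_lt {n : ℕ} (hn : 3 ≤ n) (i j : Fin n) (hij : (i : ℕ) < j) :
    (B n).M i j = if (i : ℕ) + 1 = j then (if (j : ℕ) + 1 = n then 4 else 3) else 2 := by
  simp only [B, CoxeterMatrix.B, Matrix.of_apply, Fin.ext_iff]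
  split_ifs <;> omega

/-- The pivots are those of type A until the double link, where cos² = 1/2 and the previous pivot
n/(2(n - 1)) give 1 - (n - 1)/n = 1/n. -/
theorem B_pivot {n : ℕ} (hn : 3 ≤ n) (i j : Fin n) (hij : (i : ℕ) + 1 = j) :
    (if (j : ℕ) + 1 = n then (1 / n : ℝ) else ((j : ℕ) + 2) / (2 * ((j : ℕ) + 1))) =
      1 - cos (π / ((B n).M i j : ℝ)) ^ 2 /
        (if (i : ℕ) + 1 = n then (1 / n : ℝ) else ((i : ℕ) + 2) / (2 * ((i : ℕ) + 1))) := by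
  rw [B_M_of_lt hn i j (by omega), if_pos hij, if_neg (by omega : ¬ (i : ℕ) + 1 = n)]
  by_cases h : (j : ℕ) + 1 = n
  · have h2 : (n : ℝ) = i + 2 := by
      have : n = i + 2 := by omega
      exact_mod_cast this
    rw [if_pos h, if_pos h, h2]
    have hs : √2 ^ 2 = (2 : ℝ) := sq_sqrt (by norm_num)
    push_cast
    rw [cos_pi_div_four, div_pow, hs]
    field_simp
    ring
  · rw [if_neg h, if_neg h, ← hij]
    have := A_pivot i
    simpa using this

theorem B_pivot_pos {n : ℕ} (hn : 3 ≤ n) (k : ℕ) :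
    0 < if k + 1 = n then (1 / n : ℝ) else (k + 2) / (2 * (k + 1)) := by
  have : (0 : ℝ) < n := by exact_mod_cast (by omega : 0 < n)
  split_ifs <;> positivity

theorem givesPlatonicSolid_B {n : ℕ} (hn : 3 ≤ n) : (B n).GivesPlatonicSolid := by
  refine givesPlatonicSolid_of_pivots (by omega) (fun i j hij => ?_) (fun i j hij => ?_)
    (fun k => if k + 1 = n then (1 / n : ℝ) else (k + 2) / (2 * (k + 1)))
    ?_ (fun k _ => B_pivot_pos hn k) (B_pivot hn)
    (fun i => if (i : ℕ) + 1 = n then 1 else √2) (fun i => ?_) (fun i j hij h1 h2 => ?_)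
    (fun i j h _ => ?_) (fun i j h h6 => ?_)
  · rw [B_M_of_lt hn i j (by omega), if_neg (by omega)]
  · rw [B_M_of_lt hn i j (by omega), if_pos hij]
    split_ifs <;> norm_num
  · rw [if_neg (by omega)]
    norm_num
  · split_ifs <;> positivity
  · have h4 : (B n).M i j ≠ 4 := fun h => by
      rcases ((B n).multiple_iff i j).1 (Or.inl h) with h | h
      · exact h1 h
      · exact h2 h
    have h5 : (i : ℕ) + 1 = n ↔ (j : ℕ) + 1 = n := by
      by_contra hcon
      obtain ⟨hne, h2⟩ := hij
      rcases lt_or_gt_of_ne hne with h | h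
      · rw [B_M_of_lt hn i j h] at h2 h4
        split_ifs at h2 h4 <;> omega
      · rw [(B n).M.symmetric, B_M_of_lt hn j i h] at h2 h4
        split_ifs at h2 h4 <;> omega
    simp only [h5]
  · obtain ⟨h1, h2⟩ : (i : ℕ) + 2 = n ∧ (j : ℕ) + 1 = n := h
    rw [if_neg (by omega), if_pos h2, mul_one]
  · obtain ⟨h1, h2⟩ : (i : ℕ) + 2 = n ∧ (j : ℕ) + 1 = n := h
    rw [B_M_of_lt hn i j (by omega)] at h6
    split_ifs at h6 <;> omega

theorem givesPlatonicSolid_C {n : ℕ} (hn : 3 ≤ n) : (C n).GivesPlatonicSolid := by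
  refine givesPlatonicSolid_of_pivots (by omega) (fun i j hij => ?_) (fun i j hij => ?_)
    (fun k => if k + 1 = n then (1 / n : ℝ) else (k + 2) / (2 * (k + 1)))
    ?_ (fun k _ => B_pivot_pos hn k) (B_pivot hn)
    (fun i => if (i : ℕ) + 1 = n then √2 else 1) (fun i => ?_) (fun i j hij h1 h2 => ?_)
    (fun i j h _ => ?_) (fun i j h h6 => ?_)
  · change (B n).M i j = 2
    rw [B_M_of_lt hn i j (by omega), if_neg (by omega)]
  · change (B n).M i j ≠ 2
    rw [B_M_of_lt hn i j (by omega), if_pos hij]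
    split_ifs <;> norm_num
  · rw [if_neg (by omega)]
    norm_num
  · split_ifs <;> positivity
  · have h4 : (B n).M i j ≠ 4 := fun h => by
      rcases ((C n).multiple_iff i j).1 (Or.inl h) with h | h
      · exact h1 h
      · exact h2 h
    have h5 : (i : ℕ) + 1 = n ↔ (j : ℕ) + 1 = n := by
      by_contra hcon
      obtain ⟨hne, h2⟩ := hij
      change (B n).M i j ≠ 2 at h2
      rcases lt_or_gt_of_ne hne with h | h
      · rw [B_M_of_lt hn i j h] at h2 h4
        split_ifs at h2 h4 <;> omega
      · rw [(B n).M.symmetric, B_M_of_lt hn j i h] at h2 h4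
        split_ifs at h2 h4 <;> omega
    simp only [h5]
  · obtain ⟨h1, h2⟩ : (i : ℕ) + 1 = n ∧ (j : ℕ) + 2 = n := h
    rw [if_pos h1, if_neg (by omega), mul_one]
  · obtain ⟨h1, h2⟩ : (i : ℕ) + 1 = n ∧ (j : ℕ) + 2 = n := h
    change (B n).M i j = 6 at h6
    rw [(B n).M.symmetric, B_M_of_lt hn j i (by omega)] at h6
    split_ifs at h6 <;> omega

theorem givesPlatonicSolid_F₄ : F₄.GivesPlatonicSolid := by
  have hs : √2 ^ 2 = (2 : ℝ) := sq_sqrt (by norm_num)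
  refine givesPlatonicSolid_of_pivots (by omega) (fun i j => by fin_cases i <;> fin_cases j <;> decide)
    (fun i j => by fin_cases i <;> fin_cases j <;> decide)
    (fun k => if k = 0 then 1 else if k = 1 then 3 / 4 else if k = 2 then 1 / 3 else 1 / 4)
    (by simp) (fun k _ => by split_ifs <;> norm_num) (fun i j hij => ?_)
    ![√2, √2, 1, 1] (fun i => by fin_cases i <;> simp) (fun i j hij h1 h2 => ?_)
    (fun i j h _ => ?_) (fun i j h h6 => ?_)
  · fin_cases i <;> fin_cases j <;> simp at hij <;>
      simp [F₄, CoxeterMatrix.F₄, div_pow, hs] <;> norm_num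
  · have h : ∀ i j : Fin 4, (i ≠ j ∧ F₄.M i j ≠ 2) → F₄.M i j ≠ 4 → ((i : ℕ) < 2 ↔ (j : ℕ) < 2) := by
      intro i j
      fin_cases i <;> fin_cases j <;> decide
    have h' := h i j hij fun h4 => by
      rcases (F₄.multiple_iff i j).1 (Or.inl h4) with h | h
      · exact h1 h
      · exact h2 h
    have e : ∀ i : Fin 4, (![√2, √2, 1, 1] : Fin 4 → ℝ) i = if (i : ℕ) < 2 then √2 else 1 := by
      intro i
      fin_cases i <;> simp
    rw [e, e]
    simp only [h']
  · obtain ⟨rfl, rfl⟩ : i = 1 ∧ j = 2 := h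
    simp
  · obtain ⟨rfl, rfl⟩ : i = 1 ∧ j = 2 := h
    exact absurd h6 (by decide)

theorem givesPlatonicSolid_H₃ : H₃.GivesPlatonicSolid := by
  have hs : √5 ^ 2 = (5 : ℝ) := sq_sqrt (by norm_num)
  have h5 : √5 < 3 := (sqrt_lt' (by norm_num)).2 (by norm_num)
  refine givesPlatonicSolid_of_pivots (by omega) (fun i j => by fin_cases i <;> fin_cases j <;> decide)
    (fun i j => by fin_cases i <;> fin_cases j <;> decide)
    -- The last pivot is 1 - cos²(π/5)/(3/4), with cos²(π/5) = (3 + √5)/8.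
    (fun k => if k = 0 then 1 else if k = 1 then 3 / 4 else (3 - √5) / 6)
    (by simp) (fun k _ => ?_) (fun i j hij => ?_)
    (fun _ => 1) (fun _ => one_pos) (fun _ _ _ _ _ => rfl) (fun _ _ h => h.elim)
    (fun _ _ h => h.elim)
  · split_ifs
    · norm_num
    · norm_num
    · linarith
  · fin_cases i <;> fin_cases j <;> simp at hij <;>
      simp [H₃, CoxeterMatrix.H₃]
    · norm_num
    · linear_combination (1 / 12) * hs

theorem givesPlatonicSolid_H₄ : H₄.GivesPlatonicSolid := by
  have hs : √5 ^ 2 = (5 : ℝ) := sq_sqrt (by norm_num)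
  -- Exactly the positivity of the last pivot 1 - cos²(π/5)/(2/3) = (7 - 3√5)/16.
  have h5 : √5 < 7 / 3 := (sqrt_lt' (by norm_num)).2 (by norm_num)
  refine givesPlatonicSolid_of_pivots (by omega) (fun i j => by fin_cases i <;> fin_cases j <;> decide)
    (fun i j => by fin_cases i <;> fin_cases j <;> decide)
    (fun k => if k = 0 then 1 else if k = 1 then 3 / 4 else if k = 2 then 2 / 3 else
      (7 - 3 * √5) / 16)
    (by simp) (fun k _ => ?_) (fun i j hij => ?_)
    (fun _ => 1) (fun _ => one_pos) (fun _ _ _ _ _ => rfl) (fun _ _ h => h.elim)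
    (fun _ _ h => h.elim)
  · split_ifs
    · norm_num
    · norm_num
    · norm_num
    · linarith
  · fin_cases i <;> fin_cases j <;> simp at hij <;>
      simp [H₄, CoxeterMatrix.H₄]
    · norm_num
    · norm_num
    · linear_combination (3 / 32) * hs

theorem SameType.givesPlatonicSolid {n : ℕ} {D E : CoxeterDynkinDiagram (Fin n)}
    (h : D.SameType E) (hE : E.GivesPlatonicSolid) : D.GivesPlatonicSolid := by
  obtain ⟨e, hM, hl⟩ := h
  obtain ⟨α, hα, hfin, x, hx⟩ := hE
  have hW : reflectionGroup (α ∘ e) = reflectionGroup α := by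
    unfold reflectionGroup
    congr 1
    exact e.surjective.range_comp fun i => (ℝ ∙ α i)ᗮ.reflection
  refine ⟨α ∘ e, ⟨hα.linearIndependent.comp e e.injective, fun i j => ?_, fun i j h h1 h2 => ?_,
    fun i j h h4 => ?_, fun i j h h6 => ?_⟩, hW ▸ hfin, x, hW ▸ hx⟩
  · rw [hM]
    exact hα.inner_eq _ _
  · exact hα.norm_eq _ _ ⟨e.injective.ne h.1, hM i j ▸ h.2⟩ (fun h' => h1 ((hl i j).2 h'))
      fun h' => h2 ((hl j i).2 h')
  · exact hα.norm_double _ _ ((hl i j).1 h) (hM i j ▸ h4)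
  · exact hα.norm_triple _ _ ((hl i j).1 h) (hM i j ▸ h6)

end CoxeterDynkinDiagram

end Existence

/-! ### The classification -/

namespace CoxeterDynkinDiagram

/-- The nodes of `D`, in the order given by `e`, form a path with the labels `m`. -/
structure IsPath {n : ℕ} {ι : Type*} (D : CoxeterDynkinDiagram ι) (e : Fin n ≃ ι) (m : ℕ → ℕ) :
    Prop where
  far : ∀ i j : Fin n, (i : ℕ) + 1 < j → D.M (e i) (e j) = 2
  adj : ∀ i j : Fin n, (i : ℕ) + 1 = j → D.M (e i) (e j) = m i

theorem IsPath.reverse {n : ℕ} {ι : Type*} {D : CoxeterDynkinDiagram ι} {e : Fin n ≃ ι}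
    {m : ℕ → ℕ} (h : D.IsPath e m) : D.IsPath (Fin.revPerm.trans e) fun k => m (n - 2 - k) where
  far i j hij := by
    rw [D.M.symmetric]
    refine h.far _ _ ?_
    rw [Fin.revPerm_apply, Fin.revPerm_apply, Fin.val_rev, Fin.val_rev]
    omega
  adj i j hij := by
    rw [D.M.symmetric]
    have h' := h.adj (Fin.rev j) (Fin.rev i) (by rw [Fin.val_rev, Fin.val_rev]; omega)
    have e' : ((Fin.rev j : Fin n) : ℕ) = n - 2 - i := by
      rw [Fin.val_rev]
      omega
    rw [e'] at h'
    exact h'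

theorem not_longer_self {ι : Type*} (D : CoxeterDynkinDiagram ι) (i : ι) : ¬ D.longer i i :=
  fun h => D.longer_asymm i i h h

/-- Diagrams whose nodes form paths are of the same type when their labels and their long nodes
agree along the paths. -/
theorem IsPath.sameType {n : ℕ} {ι : Type*} {D : CoxeterDynkinDiagram ι}
    {E : CoxeterDynkinDiagram (Fin n)} {e : Fin n ≃ ι} {m : ℕ → ℕ} (h : D.IsPath e m)
    (hE : E.IsPath (Equiv.refl _) m)
    (hl : ∀ i j : Fin n, (i : ℕ) + 1 = j → (m i = 4 ∨ m i = 6) →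
      (D.longer (e i) (e j) ↔ E.longer i j)) : D.SameType E := by
  have hMlt : ∀ i j : Fin n, (i : ℕ) < j → D.M (e i) (e j) = E.M i j := by
    intro i j hij
    by_cases h1 : (i : ℕ) + 1 = j
    · rw [h.adj i j h1]
      exact (hE.adj i j h1).symm
    · rw [h.far i j (by omega)]
      exact (hE.far i j (by omega)).symm
  have hM : ∀ i j : Fin n, D.M (e i) (e j) = E.M i j := by
    intro i j
    rcases lt_trichotomy (i : ℕ) j with hij | hij | hij
    · exact hMlt i j hij
    · obtain rfl := Fin.ext hij
      simp
    · rw [D.M.symmetric, E.M.symmetric]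
      exact hMlt j i hij
  have hD4 : ∀ i j : Fin n, E.longer i j → D.longer (e i) (e j) ∨ D.longer (e j) (e i) := by
    intro i j h
    rw [← D.multiple_iff, hM]
    exact (E.multiple_iff i j).2 (Or.inl h)
  have hE4 : ∀ i j : Fin n, D.longer (e i) (e j) → E.longer i j ∨ E.longer j i := by
    intro i j h
    rw [← E.multiple_iff, ← hM]
    exact (D.multiple_iff _ _).2 (Or.inl h)
  have hllt : ∀ i j : Fin n, (i : ℕ) < j → (D.longer (e i) (e j) ↔ E.longer i j) := by
    intro i j hij
    by_cases hm : E.M i j = 4 ∨ E.M i j = 6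
    · by_cases h1 : (i : ℕ) + 1 = j
      · refine hl i j h1 ?_
        have h2 : E.M i j = m i := hE.adj i j h1
        rwa [← h2]
      · have h2 : E.M i j = 2 := hE.far i j (by omega)
        omega
    · constructor
      · intro h'
        exact absurd ((E.multiple_iff i j).2 (hE4 i j h')) hm
      · intro h'
        exact absurd ((E.multiple_iff i j).2 (Or.inl h')) hm
  have hlon : ∀ i j : Fin n, D.longer (e i) (e j) ↔ E.longer i j := by
    intro i j
    rcases lt_trichotomy (i : ℕ) j with hij | hij | hij
    · exact hllt i j hij
    · obtain rfl := Fin.ext hij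
      exact iff_of_false (D.not_longer_self _) (E.not_longer_self _)
    -- A multiple link has exactly one orientation, so the reversed pair follows from the ordered
    -- one by asymmetry.
    · have h1 := hllt j i hij
      constructor
      · intro h'
        exact (hE4 i j h').resolve_right fun h2 => D.longer_asymm _ _ h' (h1.2 h2)
      · intro h'
        exact (hD4 i j h').resolve_right fun h2 => E.longer_asymm _ _ h' (h1.1 h2)
  refine ⟨e.symm, fun i j => ?_, fun i j => ?_⟩
  · simpa using hM (e.symm i) (e.symm j)
  · simpa using hlon (e.symm i) (e.symm j)

theorem IsPath.congr {n : ℕ} {ι : Type*} {D : CoxeterDynkinDiagram ι} {e : Fin n ≃ ι}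
    {m m' : ℕ → ℕ} (h : D.IsPath e m) (hm : ∀ k, k + 1 < n → m k = m' k) : D.IsPath e m' :=
  ⟨h.far, fun i j hij => (h.adj i j hij).trans (hm i (by omega))⟩

theorem A_isPath (n : ℕ) : (A n).IsPath (Equiv.refl _) fun _ => 3 where
  far i j hij := by
    simp only [A, CoxeterMatrix.A, Matrix.of_apply, Fin.ext_iff, Equiv.refl_apply]
    split_ifs <;> omega
  adj i j hij := by
    simp only [A, CoxeterMatrix.A, Matrix.of_apply, Fin.ext_iff, Equiv.refl_apply]
    split_ifs <;> omega

theorem B_isPath {n : ℕ} (hn : 3 ≤ n) :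
    (B n).IsPath (Equiv.refl _) fun k => if k + 2 = n then 4 else 3 where
  far i j hij := by
    rw [Equiv.refl_apply, Equiv.refl_apply, B_M_of_lt hn i j (by omega), if_neg (by omega)]
  adj i j hij := by
    rw [Equiv.refl_apply, Equiv.refl_apply, B_M_of_lt hn i j (by omega), if_pos hij]
    split_ifs <;> omega

theorem F₄_isPath : F₄.IsPath (Equiv.refl _) fun k => if k = 1 then 4 else 3 where
  far i j hij := by
    fin_cases i <;> fin_cases j <;> simp at hij <;> rfl
  adj i j hij := by
    fin_cases i <;> fin_cases j <;> simp at hij <;> rfl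

theorem H₃_isPath : H₃.IsPath (Equiv.refl _) fun k => if k = 1 then 5 else 3 where
  far i j hij := by
    fin_cases i <;> fin_cases j <;> simp at hij <;> rfl
  adj i j hij := by
    fin_cases i <;> fin_cases j <;> simp at hij <;> rfl

theorem H₄_isPath : H₄.IsPath (Equiv.refl _) fun k => if k = 2 then 5 else 3 where
  far i j hij := by
    fin_cases i <;> fin_cases j <;> simp at hij <;> rfl
  adj i j hij := by
    fin_cases i <;> fin_cases j <;> simp at hij <;> rfl

theorem IsPath.sameType_B_or_C {n : ℕ} (hn : 3 ≤ n) {ι : Type*} {D : CoxeterDynkinDiagram ι}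
    {e : Fin n ≃ ι} (h : D.IsPath e fun k => if k + 2 = n then 4 else 3) :
    D.SameType (B n) ∨ D.SameType (C n) := by
  have hind : ∀ i j : Fin n, (i : ℕ) + 1 = j →
      ((if (i : ℕ) + 2 = n then 4 else 3) = 4 ∨ (if (i : ℕ) + 2 = n then 4 else 3) = 6) →
      i = ⟨n - 2, by omega⟩ ∧ j = ⟨n - 1, by omega⟩ := by
    intro i j hij hm
    have : (i : ℕ) + 2 = n := by
      by_contra hne
      simp [hne] at hm
    exact ⟨Fin.ext (by simp only; omega), Fin.ext (by simp only; omega)⟩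
  by_cases hl : D.longer (e ⟨n - 2, by omega⟩) (e ⟨n - 1, by omega⟩)
  · refine Or.inl (h.sameType (B_isPath hn) fun i j hij hm => ?_)
    obtain ⟨rfl, rfl⟩ := hind i j hij hm
    exact iff_of_true hl ⟨by simp only; omega, by simp only; omega⟩
  · refine Or.inr (h.sameType (E := C n) ⟨(B_isPath hn).far, (B_isPath hn).adj⟩
      fun i j hij hm => ?_)
    obtain ⟨rfl, rfl⟩ := hind i j hij hm
    refine iff_of_false hl fun h' => ?_
    have h1 : n - 2 + 1 = n ∧ n - 1 + 2 = n := h'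
    omega

theorem IsPath.sameType_F₄ {ι : Type*} {D : CoxeterDynkinDiagram ι} {e : Fin 4 ≃ ι}
    (h : D.IsPath e fun k => if k = 1 then 4 else 3) (hl : D.longer (e 1) (e 2)) :
    D.SameType F₄ := by
  refine h.sameType F₄_isPath fun i j hij hm => ?_
  have hi : (i : ℕ) = 1 := by
    by_contra hne
    simp [hne] at hm
  obtain rfl : i = 1 := Fin.ext hi
  obtain rfl : j = 2 := Fin.ext (by rw [← hij]; rfl)
  exact iff_of_true hl ⟨rfl, rfl⟩

/-- The labels 3, 4, 3 are palindromic, so reversing the line exchanges the two orientations of the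
double link; this is why F₄ yields one diagram where type B/C yields two. -/
theorem IsPath.sameType_F₄_of_eq {ι : Type*} {D : CoxeterDynkinDiagram ι} {e : Fin 4 ≃ ι}
    (h : D.IsPath e fun k => if k = 1 then 4 else 3) : D.SameType F₄ := by
  have h4 : D.M (e 1) (e 2) = 4 := h.adj 1 2 rfl
  rcases (D.multiple_iff _ _).1 (Or.inl h4) with hl | hl
  · exact h.sameType_F₄ hl
  · refine (h.reverse.congr fun k hk => ?_).sameType_F₄ hl
    have hk3 : k < 3 := by omega
    interval_cases k <;> rfl

/-- The classification of paths with positive definite Gram matrix. -/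
theorem IsPath.classification {n : ℕ} (hn : 3 ≤ n) {ι : Type*} {D : CoxeterDynkinDiagram ι}
    {e : Fin n ≃ ι} {m : ℕ → ℕ} (h : D.IsPath e m)
    (hm : (∀ k, k + 1 < n → m k = 3) ∨ ∃ k, k + 1 < n ∧ (∀ j, j ≠ k → j + 1 < n → m j = 3) ∧
      ((m k = 4 ∧ (k = 0 ∨ k + 2 = n ∨ n = 4 ∧ k = 1)) ∨
        (m k = 5 ∧ n ≤ 4 ∧ (k = 0 ∨ k + 2 = n)))) :
    D.SameType (A n) ∨ D.SameType (B n) ∨ D.SameType (C n) ∨ D.SameType F₄ ∨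
      D.SameType H₃ ∨ D.SameType H₄ := by
  have hBC : (∃ e : Fin n ≃ ι, D.IsPath e fun k => if k + 2 = n then 4 else 3) →
      D.SameType (A n) ∨ D.SameType (B n) ∨ D.SameType (C n) ∨ D.SameType F₄ ∨
      D.SameType H₃ ∨ D.SameType H₄ := by
    rintro ⟨e, h⟩
    rcases h.sameType_B_or_C hn with h | h
    · exact Or.inr (Or.inl h)
    · exact Or.inr (Or.inr (Or.inl h))
  have hH : n ≤ 4 → (∃ e : Fin n ≃ ι, D.IsPath e fun k => if k + 2 = n then 5 else 3) →
      D.SameType (A n) ∨ D.SameType (B n) ∨ D.SameType (C n) ∨ D.SameType F₄ ∨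
      D.SameType H₃ ∨ D.SameType H₄ := by
    rintro h4 ⟨e, h⟩
    have hn' : n = 3 ∨ n = 4 := by omega
    rcases hn' with rfl | rfl
    · have h' : D.IsPath e fun k => if k = 1 then 5 else 3 := by simpa using h
      refine Or.inr (Or.inr (Or.inr (Or.inr (Or.inl (h'.sameType H₃_isPath fun i j hij hm => ?_)))))
      split_ifs at hm <;> omega
    · have h' : D.IsPath e fun k => if k = 2 then 5 else 3 := by simpa using h
      refine Or.inr (Or.inr (Or.inr (Or.inr (Or.inr (h'.sameType H₄_isPath fun i j hij hm => ?_)))))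
      split_ifs at hm <;> omega
  rcases hm with hm | ⟨k, hk, hother, ⟨hmk, hpos⟩ | ⟨hmk, hn4, hpos⟩⟩
  · refine Or.inl ((h.congr hm).sameType (A_isPath n) fun i j _ hm => ?_)
    omega
  · rcases hpos with rfl | hpos | ⟨rfl, rfl⟩
    -- An exceptional first link becomes the last one after reversal.
    · refine hBC ⟨_, h.reverse.congr fun j hj => ?_⟩
      by_cases hj' : j + 2 = n
      · rw [if_pos hj', show n - 2 - j = 0 by omega, hmk]
      · rw [if_neg hj', hother _ (by omega) (by omega)]
    · refine hBC ⟨_, h.congr fun j hj => ?_⟩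
      by_cases hj' : j + 2 = n
      · rw [if_pos hj', show j = k by omega, hmk]
      · rw [if_neg hj', hother _ (by omega) (by omega)]
    · refine Or.inr (Or.inr (Or.inr (Or.inl (IsPath.sameType_F₄_of_eq
        (h.congr fun j hj => ?_)))))
      by_cases hj' : j = 1
      · rw [if_pos hj', hj', hmk]
      · rw [if_neg hj', hother _ hj' hj]
  · rcases hpos with rfl | hpos
    · refine hH hn4 ⟨_, h.reverse.congr fun j hj => ?_⟩
      by_cases hj' : j + 2 = n
      · rw [if_pos hj', show n - 2 - j = 0 by omega, hmk]
      · rw [if_neg hj', hother _ (by omega) (by omega)]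
    · refine hH hn4 ⟨_, h.congr fun j hj => ?_⟩
      by_cases hj' : j + 2 = n
      · rw [if_pos hj', show j = k by omega, hmk]
      · rw [if_neg hj', hother _ (by omega) (by omega)]

/-! ### From a Platonic solid to a labelled path -/

theorem Connected.exists_adj_notMem {ι : Type*} {D : CoxeterDynkinDiagram ι} (hD : D.Connected)
    [Fintype ι] {K : Finset ι} (hK : K.Nonempty) (hK' : K ≠ Finset.univ) :
    ∃ k ∈ K, ∃ j ∉ K, D.graph.Adj k j := by
  obtain ⟨u, hu⟩ := hK
  obtain ⟨v, hv⟩ : ∃ v, v ∉ K := by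
    by_contra hcon
    push Not at hcon
    exact hK' (Finset.eq_univ_iff_forall.2 hcon)
  obtain ⟨p⟩ := hD.preconnected u v
  obtain ⟨d, -, h1, h2⟩ := p.exists_boundary_dart (K : Set ι) hu hv
  exact ⟨d.fst, h1, d.snd, h2, d.adj⟩

theorem isUnitPath_of_isPath {n : ℕ} {ι V : Type*} [NormedAddCommGroup V] [InnerProductSpace ℝ V]
    {D : CoxeterDynkinDiagram ι} {b : Module.Basis ι ℝ V} (hb : IsGeometricBasis D.M b)
    {e : Fin n ≃ ι} {m : ℕ → ℕ} (h : D.IsPath e m) (hm : ∀ k, k + 1 < n → 3 ≤ m k) :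
    IsUnitPath n m fun k => if hk : k < n then b (e ⟨k, hk⟩) else 0 where
  three_le := hm
  inner_self k hk := by
    simp only [dif_pos hk]
    exact hb.inner_self _
  inner_succ k hk := by
    simp only [dif_pos hk, dif_pos (by omega : k < n)]
    rw [hb.inner_eq, h.adj _ _ rfl]
  inner_far j k hjk hk := by
    simp only [dif_pos hk, dif_pos (by omega : j < n)]
    exact hb.inner_eq_zero (h.far _ _ hjk)
  exists_coord i hi := by
    refine ⟨b.coord (e ⟨i, hi⟩), ?_, fun k hk hki => ?_⟩
    · simp only [dif_pos hi]
      simp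
    · simp only [dif_pos hk]
      rw [b.coord_apply, b.repr_self]
      exact Finsupp.single_eq_of_ne fun h' => hki (by
        have := e.injective h'
        rw [Fin.mk.injEq] at this
        exact this.symm)

end CoxeterDynkinDiagram

/-- The orbit polytope of 0 is a point, whereas a Platonic polytope must have an edge. -/
theorem IsPlatonic.ne_zero {V : Type*} [NormedAddCommGroup V] [InnerProductSpace ℝ V]
    {W : Subgroup (V ≃ₗᵢ[ℝ] V)} {x : V} (h : IsPlatonic W x) (hV : 1 < Module.finrank ℝ V) :
    x ≠ 0 := by
  rintro rfl
  obtain ⟨F, hF⟩ := h 1 hV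
  have hmem : F ∈ facesOfDim (orbitPolytope W 0) 1 := by
    rw [hF]
    exact ⟨1, one_mem _, by simp⟩
  obtain ⟨hne, hexp, hdim⟩ := hmem
  have hsub : F ⊆ {0} := by
    refine hexp.subset.trans (convexHull_min ?_ (convex_singleton 0))
    rintro _ ⟨w, -, rfl⟩
    simp
  have hspan : vectorSpan ℝ F = ⊥ := vectorSpan_of_subsingleton ℝ
    (Set.subsingleton_singleton.anti hsub)
  rw [hspan, finrank_bot] at hdim
  exact zero_ne_one hdim

theorem CoxeterDynkinDiagram.GivesPlatonicSolid.exists_isPath {n : ℕ} (hn : 3 ≤ n)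
    {D : CoxeterDynkinDiagram (Fin n)} (hD : D.Connected) (h : D.GivesPlatonicSolid) :
    ∃ (e : Fin n ≃ Fin n) (m : ℕ → ℕ), D.IsPath e m ∧
      ((∀ k, k + 1 < n → m k = 3) ∨ ∃ k, k + 1 < n ∧ (∀ j, j ≠ k → j + 1 < n → m j = 3) ∧
      ((m k = 4 ∧ (k = 0 ∨ k + 2 = n ∨ n = 4 ∧ k = 1)) ∨
        (m k = 5 ∧ n ≤ 4 ∧ (k = 0 ∨ k + 2 = n)))) := by
  obtain ⟨α, hα, -, x, hx⟩ := h
  have : Nonempty (Fin n) := ⟨⟨0, by omega⟩⟩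
  obtain ⟨b, hb, hW⟩ := hα.exists_isGeometricBasis (by simp)
  rw [← hW] at hx
  -- Replacing x by a dominant point of its orbit leaves the polytope unchanged.
  obtain ⟨g, hg, hdom⟩ := hb.exists_isDominant x
  have hP : IsPlatonic (reflectionGroup b) (g x) := by
    unfold IsPlatonic
    rw [orbitPolytope_apply hg]
    exact hx
  have hne := hP.ne_zero (by simp; omega)
  obtain ⟨i₀, hi₀⟩ : ∃ i, inner ℝ (g x) (b i) ≠ (0 : ℝ) := by
    by_contra hcon
    push Not at hcon
    refine hne (InnerProductSpace.ext_inner_right_basis b fun i => ?_)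
    rw [hcon, inner_zero_left]
  obtain ⟨e, he⟩ := hb.exists_equiv_of_isPlatonic (Fintype.card_fin n) hdom hP hi₀
    fun K hK hK' => by
      obtain ⟨k, hk, j, hj, h⟩ := hD.exists_adj_notMem hK hK'
      exact ⟨k, hk, j, hj, (hb.inner_neg h.1 h.2).ne⟩
  have hfar : ∀ i j : Fin n, (i : ℕ) + 1 < j → D.M (e i) (e j) = 2 := by
    intro i j hij
    have hlt : i < j := Fin.lt_def.2 (by omega)
    by_contra hM
    have := (he i j hlt).1 (hb.inner_neg (e.injective.ne hlt.ne) hM).ne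
    omega
  have hadj : ∀ i j : Fin n, (i : ℕ) + 1 = j → 3 ≤ D.M (e i) (e j) := by
    intro i j hij
    have hlt : i < j := Fin.lt_def.2 (by omega)
    have h1 := (he i j hlt).2 hij
    have h2 := hb.two_le (e.injective.ne hlt.ne)
    have h3 : D.M (e i) (e j) ≠ 2 := fun h3 => h1 (hb.inner_eq_zero h3)
    omega
  set m : ℕ → ℕ := fun k => if hk : k + 1 < n then D.M (e ⟨k, by omega⟩) (e ⟨k + 1, hk⟩) else 3
    with hm
  have hpath : D.IsPath e m := by
    refine ⟨hfar, fun i j hij => ?_⟩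
    obtain ⟨j, hj⟩ := j
    change (i : ℕ) + 1 = j at hij
    subst hij
    simp only [hm, dif_pos hj]
  refine ⟨e, m, hpath, (D.isUnitPath_of_isPath hb hpath fun k hk => ?_).labels hn⟩
  simp only [hm, dif_pos hk]
  exact hadj _ _ rfl

theorem mainTheorem2 (n : ℕ) (hn : 3 ≤ n) (D : CoxeterDynkinDiagram (Fin n))
    (hD : D.Connected) :
    D.GivesPlatonicSolid ↔
      D.SameType (CoxeterDynkinDiagram.A n) ∨ D.SameType (CoxeterDynkinDiagram.B n) ∨
      D.SameType (CoxeterDynkinDiagram.C n) ∨ D.SameType CoxeterDynkinDiagram.F₄ ∨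
      D.SameType CoxeterDynkinDiagram.H₃ ∨ D.SameType CoxeterDynkinDiagram.H₄ := by
  constructor
  · intro h
    obtain ⟨e, m, hpath, hm⟩ := h.exists_isPath hn hD
    exact hpath.classification hn hm
  · rintro (h | h | h | h | h | h)
    · exact h.givesPlatonicSolid (CoxeterDynkinDiagram.givesPlatonicSolid_A hn)
    · exact h.givesPlatonicSolid (CoxeterDynkinDiagram.givesPlatonicSolid_B hn)
    · exact h.givesPlatonicSolid (CoxeterDynkinDiagram.givesPlatonicSolid_C hn)
    -- The renumbering is a bijection of node sets, which fixes n.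
    · obtain rfl : n = 4 := by simpa using Fintype.card_congr h.choose
      exact h.givesPlatonicSolid CoxeterDynkinDiagram.givesPlatonicSolid_F₄
    · obtain rfl : n = 3 := by simpa using Fintype.card_congr h.choose
      exact h.givesPlatonicSolid CoxeterDynkinDiagram.givesPlatonicSolid_H₃
    · obtain rfl : n = 4 := by simpa using Fintype.card_congr h.choose
      exact h.givesPlatonicSolid CoxeterDynkinDiagram.givesPlatonicSolid_H₄
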